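/- Work over $\mathbb{C}$. Write a quaternary quartic as $F(x)=\sum_{i_1,\dots,i_4=1}^{4}F_{i_1i_2i_3i_4}\,x_{i_1}x_{i_2}x_{i_3}x_{i_4}$ with $F_{i_1i_2i_3i_4}$ symmetric in its indices, and let $\epsilon_{i_1i_2i_3i_4}$ be the completely antisymmetric tensor (the sign of the permutation $i_1,\dots,i_4$, and $0$ if an index is repeated). More generally, let $G$ be a hypergraph on a finite vertex set $\mathcal A$ with a finite family of blocks (repeated blocks allowed), each consisting of $n+1$ distinct vertices listed in some order, such that every vertex lies in exactly $d$ blocks. To $G$ one associates the polynomial $I_G(F)$ in the coefficients of forms $F$ of degree $d$ in $n+1$ variables obtained by giving an index in $\{1,\dots,n+1\}$ to each incidence of a vertex with a block and summing, over all choices of indices, $$\prod_{\text{blocks } b}\epsilon_{\text{indices at } b}\ \prod_{\text{vertices } v}F_{\text{indices at } v}.$$ The product of the brackets $(v_0v_1\cdots v_n)$ over the blocks is called the symbolic expression of $I_G$. The collinearity graph of $G$ joins two distinct vertices when they lie in a common block, and the chromatic number of $G$ is that of this graph; a coloring of $\mathcal A$ is proper if the vertices of each block receive distinct colors. Let $\sigma_k(v_d(\mathbb{P}^n))$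 be the Zariski closure, in the projective space of forms of degree $d$ in $n+1$ variables, of the union of the subspaces spanned by $k$ points $[L^d]$, $L$ a nonzero linear form. A polynomial is a defining equation of this variety if the variety is its zero set and the polynomial generates the homogeneous ideal of the variety. The triple $(k,d,n)$ is called chromatic if $\sigma_k(v_d(\mathbb{P}^n))$ has codimension $1$ and has a defining equation of the form $I_G$ for a single hypergraph $G$ as above whose chromatic number is $k+1$. **Theorem.** Let $G$ be the hypergraph on the ten vertices $a,b,\dots,j$ with the ten blocks of the symbolic expression $$(abcd)(abgj)(aefg)(afhi)(bdef)(behi)(cdgh)(ceij)(cfhj)(dgij).$$ Then: 1. $I_G$ is not identically zero, is homogeneous of degree $10$ in the coefficients of the quartic $F$, and is $SL_4$-invariant: $I_G(F\circ g)=I_G(F)$ for all quaternary quartics $F$ and all $g$ with $\det g=1$. 2. $I_G$ is a defining equation of $\sigma_9(v_4(\mathbb{P}^3))$, which is of codimension $1$. 3. The collinearity graph of $G$ is the complete graph on the ten vertices (a $10$-clique); hence $G$ has no proper coloring with $9$ colors. In particular, the triple $(9,4,3)$ is chromatic. -/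

import Mathlib

open scoped LinearAlgebra.Projectivization

noncomputable section

namespace SecantInvariant

/-- Complex forms (homogeneous polynomials) of degree `d` in the `n + 1` variables
`x_0, …, x_n`. -/
abbrev Form (n d : ℕ) : Type := MvPolynomial.homogeneousSubmodule (Fin (n + 1)) ℂ d

/-- Polynomials in the coefficients `f_s` of the general form of degree `d` in `n + 1` variables.
The variables are indexed by the multisets `s` of `d` indices: a form is written as
`F = ∑_s (multinomial coefficient of s) * f_s * ∏_{i ∈ s} x_i`. -/
abbrev CoeffRing (n d : ℕ) : Type := MvPolynomial (Sym (Fin (n + 1)) d) ℂ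

/-- The entry `F_{i_1, …, i_d} = f_s`, where `s = {i_1, …, i_d}`, of the symmetric tensor of a
form `F` of degree `d`: the coefficient of `∏_{i ∈ s} x_i` in `F`, divided by the multinomial
coefficient of `s`. -/
def tensorEntry {n : ℕ} (d : ℕ) (F : MvPolynomial (Fin (n + 1)) ℂ) (s : Sym (Fin (n + 1)) d) : ℂ :=
  F.coeff (Multiset.toFinsupp (s : Multiset (Fin (n + 1)))) /
    (Nat.multinomial Finset.univ
      (fun i : Fin (n + 1) => Multiset.count i (s : Multiset (Fin (n + 1)))) : ℂ)

/-- The value `P(F)` at the form `F` of a polynomial `P` in the coefficients of forms. -/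
def evalAt {n d : ℕ} (P : CoeffRing n d) (F : MvPolynomial (Fin (n + 1)) ℂ) : ℂ :=
  MvPolynomial.eval (tensorEntry d F) P

/-! ### Secant varieties of Veronese varieties -/

/-- The projective space of forms of degree `d` in `n + 1` variables. -/
abbrev FormSpace (n d : ℕ) : Type := ℙ ℂ (Form n d)

/-- The `d`-th power of a linear form. -/
def powForm {n : ℕ} (d : ℕ) (L : Form n 1) : Form n d :=
  ⟨(L : MvPolynomial (Fin (n + 1)) ℂ) ^ d, by
    have h := ((MvPolynomial.mem_homogeneousSubmodule 1 _).1 L.2).pow d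
    rw [one_mul] at h
    exact (MvPolynomial.mem_homogeneousSubmodule d _).2 h⟩

/-- The Veronese variety `v_d(ℙ^n)`: the points `[L ^ d]`. -/
def veronese (n d : ℕ) : Set (FormSpace n d) :=
  {p | ∃ (L : Form n 1) (h : powForm d L ≠ 0), p = Projectivization.mk ℂ (powForm d L) h}

/-- The union of the projective subspaces spanned by `k` points of `X`. -/
def unionOfSpans {n d : ℕ} (k : ℕ) (X : Set (FormSpace n d)) : Set (FormSpace n d) :=
  {p | ∃ q : Fin k → FormSpace n d, (∀ i, q i ∈ X) ∧ p.submodule ≤ ⨆ i, (q i).submodule}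

/-- The homogeneous polynomial `P` vanishes on the set `S` of points of projective space. -/
def VanishesOn {n d : ℕ} (P : CoeffRing n d) (S : Set (FormSpace n d)) : Prop :=
  ∀ q ∈ S, evalAt P (q.rep : MvPolynomial (Fin (n + 1)) ℂ) = 0

/-- The Zariski closure of a subset of projective space. -/
def zariskiClosure {n d : ℕ} (S : Set (FormSpace n d)) : Set (FormSpace n d) :=
  {p | ∀ (P : CoeffRing n d) (m : ℕ), P.IsHomogeneous m → VanishesOn P S → VanishesOn P {p}}

/-- The `k`-th secant variety `σ_k(v_d(ℙ^n))`. -/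
def secantVariety (k d n : ℕ) : Set (FormSpace n d) :=
  zariskiClosure (unionOfSpans k (veronese n d))

/-- The homogeneous ideal of a subset of projective space, generated by the homogeneous
polynomials that vanish on it. -/
def homogeneousIdeal {n d : ℕ} (S : Set (FormSpace n d)) : Ideal (CoeffRing n d) :=
  Ideal.span {P | (∃ m : ℕ, P.IsHomogeneous m) ∧ VanishesOn P S}

/-- The codimension in projective space of a nonempty closed subset: the height of its
homogeneous ideal. -/
def codimension {n d : ℕ} (S : Set (FormSpace n d)) : ℕ∞ := (homogeneousIdeal S).height

/-- `P` is a defining equation of `S`: the points of `S` are the zeros of `P`, and `P` generates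
the homogeneous ideal of `S`. -/
def IsDefiningEquation {n d : ℕ} (P : CoeffRing n d) (S : Set (FormSpace n d)) : Prop :=
  (∀ p : FormSpace n d, p ∈ S ↔ evalAt P (p.rep : MvPolynomial (Fin (n + 1)) ℂ) = 0) ∧
    homogeneousIdeal S = Ideal.span {P}

/-! ### Hypergraphs and their invariants -/

/-- A hypergraph on the vertex set `A` with blocks indexed by `B`, in which every block consists
of `n + 1` distinct vertices, listed in a chosen order, and every vertex is in exactly `d` blocks
(counted with multiplicity). -/
structure BlockHypergraph (A B : Type) [DecidableEq A] [Fintype B] (n d : ℕ) where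
  block : B → Fin (n + 1) → A
  block_injective : ∀ b, Function.Injective (block b)
  regular : ∀ v : A,
    (Finset.univ.filter fun p : B × Fin (n + 1) => block p.1 p.2 = v).card = d

/-- The completely antisymmetric tensor: the sign of `i` if `i` is a permutation, and `0` if an
index is repeated. -/
def epsilon {m : ℕ} (i : Fin m → Fin m) : ℤ :=
  if h : Function.Bijective i then (Equiv.Perm.sign (Equiv.ofBijective i h) : ℤ) else 0

namespace BlockHypergraph

variable {A B : Type} [Fintype A] [DecidableEq A] [Fintype B] {n d : ℕ}

/-- The legs at the vertex `v`: the incidences of `v` with the blocks. -/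
def legs (G : BlockHypergraph A B n d) (v : A) : Finset (B × Fin (n + 1)) :=
  Finset.univ.filter fun p => G.block p.1 p.2 = v

/-- The multiset of the indices carried by the `d` legs at the vertex `v`, if the `l`-th leg of
the block `b` carries the index `i b l`. -/
def indicesAt (G : BlockHypergraph A B n d) (i : B → Fin (n + 1) → Fin (n + 1)) (v : A) :
    Sym (Fin (n + 1)) d :=
  ⟨(G.legs v).val.map fun p => i p.1 p.2, by rw [Multiset.card_map]; exact G.regular v⟩

/-- The polynomial `I_G(F)` of the hypergraph `G`, with symbolic expression
`∏_b (v_{b,0} v_{b,1} … v_{b,n})`, where `v_{b,0}, …, v_{b,n}` are the vertices of the block `b`: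
the contraction of one tensor `ε` for each block with one symmetric tensor `F` for each vertex,
that is, the sum over all assignments of indices to the incidences of
`∏_b ε_{i(b,0), …, i(b,n)} * ∏_v F_{indices at v}`. -/
def invariant [DecidableEq B] (G : BlockHypergraph A B n d) : CoeffRing n d :=
  ∑ i : B → Fin (n + 1) → Fin (n + 1),
    (∏ b : B, ((epsilon (i b) : ℤ) : CoeffRing n d)) *
      ∏ v : A, MvPolynomial.X (G.indicesAt i v)

/-- Two distinct vertices are adjacent in the collinearity graph if they lie in a common block. -/
def collinearityGraph (G : BlockHypergraph A B n d) : SimpleGraph A where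
  Adj v w := v ≠ w ∧ ∃ b, v ∈ Set.range (G.block b) ∧ w ∈ Set.range (G.block b)
  symm := ⟨fun _ _ h => ⟨h.1.symm, h.2.imp fun _ hb => ⟨hb.2, hb.1⟩⟩⟩
  loopless := ⟨fun _ h => h.1 rfl⟩

/-- A coloring of the vertices is proper if the vertices of each block get distinct colors. -/
def IsProperColoring (G : BlockHypergraph A B n d) {q : ℕ} (c : A → Fin q) : Prop :=
  ∀ b, Function.Injective fun l => c (G.block b l)

end BlockHypergraph

/-- The triple `(k, d, n)` is chromatic: `σ_k(v_d(ℙ^n))` has codimension `1`, and it has a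
defining equation that is the polynomial of a single hypergraph whose chromatic number is
`k + 1`. -/
def IsChromaticTriple (k d n : ℕ) : Prop :=
  codimension (secantVariety k d n) = 1 ∧
    ∃ (a b : ℕ) (G : BlockHypergraph (Fin a) (Fin b) n d),
      IsDefiningEquation G.invariant (secantVariety k d n) ∧
        G.collinearityGraph.chromaticNumber = ((k + 1 : ℕ) : ℕ∞)

/-- The hypergraph of the symbolic expression
`(abcd)(abgj)(aefg)(afhi)(bdef)(behi)(cdgh)(ceij)(cfhj)(dgij)`,
with the letters `a, b, …, j` numbered `0, 1, …, 9`. -/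
def quarticHypergraph : BlockHypergraph (Fin 10) (Fin 10) 3 4 where
  block := ![![0, 1, 2, 3], ![0, 1, 6, 9], ![0, 4, 5, 6], ![0, 5, 7, 8], ![1, 3, 4, 5],
    ![1, 4, 7, 8], ![2, 3, 6, 7], ![2, 4, 8, 9], ![2, 5, 7, 9], ![3, 6, 8, 9]]
  block_injective := by decide
  regular := by decide

/-- The linear substitution `x_i ↦ ∑_j g_{ij} x_j` in a polynomial. -/
def substitute {n : ℕ} (g : Matrix (Fin (n + 1)) (Fin (n + 1)) ℂ)
    (F : MvPolynomial (Fin (n + 1)) ℂ) : MvPolynomial (Fin (n + 1)) ℂ :=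
  MvPolynomial.bind₁ (fun i => ∑ j, MvPolynomial.C (g i j) * MvPolynomial.X j) F

end SecantInvariant

end

noncomputable section

/-- A prime ideal of `A[X]`, with `A` factorial, that meets `A` trivially is principal. -/
theorem Polynomial.exists_eq_span_singleton_of_comap_C_eq_bot {A : Type*} [CommRing A] [IsDomain A]
    [UniqueFactorizationMonoid A] (I : Ideal (Polynomial A)) [hI : I.IsPrime]
    (hC : ∀ a : A, Polynomial.C a ∈ I → a = 0) : ∃ p, I = Ideal.span {p} := by
  classical
  by_cases hbot : I = ⊥
  · exact ⟨0, by rw [hbot, Ideal.span_singleton_eq_bot.2 rfl]⟩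
  obtain ⟨p₀, hp₀I, hp₀⟩ := hI.exists_mem_prime_of_ne_bot hbot
  have hex : ∃ n, ∃ p : Polynomial A, Prime p ∧ p ∈ I ∧ p.natDegree = n :=
    ⟨_, p₀, hp₀, hp₀I, rfl⟩
  obtain ⟨p, hp, hpI, hpn⟩ := Nat.find_spec hex
  have hsmall : ∀ g ∈ I, g.natDegree < p.natDegree → g = 0 := by
    intro g hg hlt
    by_contra hg0
    have hprod : (UniqueFactorizationMonoid.factors g).prod ∈ I := by
      obtain ⟨u, hu⟩ := (UniqueFactorizationMonoid.factors_prod hg0).symm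
      rw [← hu]
      exact I.mul_mem_right _ hg
    obtain ⟨q, hq, hqI⟩ := (hI.multiset_prod_mem_iff_exists_mem _).1 hprod
    have hqp := UniqueFactorizationMonoid.prime_of_factor q hq
    have hdvd : q ∣ g := UniqueFactorizationMonoid.dvd_of_mem_factors hq
    exact Nat.find_min hex (m := q.natDegree)
      (hpn ▸ (Polynomial.natDegree_le_of_dvd hdvd hg0).trans_lt hlt) ⟨q, hqp, hqI, rfl⟩
  refine ⟨p, le_antisymm ?_ ((Ideal.span_singleton_le_iff_mem _).2 hpI)⟩
  have hpos : 0 < p.natDegree := by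
    rw [Nat.pos_iff_ne_zero]
    intro h0
    rw [Polynomial.eq_C_of_natDegree_eq_zero h0] at hpI
    exact hp.ne_zero (by rw [Polynomial.eq_C_of_natDegree_eq_zero h0, hC _ hpI, Polynomial.C_0])
  have key : ∀ n, ∀ g ∈ I, g.natDegree ≤ n → p ∣ g := by
    have hnC : ∀ a : A, a ≠ 0 → ¬ p ∣ Polynomial.C a := by
      intro a ha hd
      have := Polynomial.natDegree_le_of_dvd hd (Polynomial.C_ne_zero.2 ha)
      rw [Polynomial.natDegree_C] at this
      omega
    intro n
    induction n with
    | zero =>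
      intro g hg hn
      rw [hsmall g hg (by omega)]
      exact dvd_zero _
    | succ n ih =>
      intro g hg hn
      rcases lt_or_ge g.natDegree p.natDegree with hlt | hge
      · rw [hsmall g hg hlt]
        exact dvd_zero _
      have hmem : p.cancelLeads g ∈ I := by
        unfold Polynomial.cancelLeads
        exact I.sub_mem (I.mul_mem_left _ hg) (I.mul_mem_left _ hpI)
      have hd : p ∣ p.cancelLeads g := by
        apply ih _ hmem
        have := Polynomial.natDegree_cancelLeads_lt_of_natDegree_le_natDegree hge (by omega)
        omega
      have hd2 : p ∣ Polynomial.C p.leadingCoeff * g := by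
        have h := hd
        unfold Polynomial.cancelLeads at h
        rw [Nat.sub_eq_zero_of_le hge, pow_zero, mul_one] at h
        exact (dvd_sub_left (dvd_mul_left p _)).1 h
      exact (hp.dvd_or_dvd hd2).resolve_left
        (hnC _ (Polynomial.leadingCoeff_ne_zero.2 hp.ne_zero))
  intro g hg
  exact Ideal.mem_span_singleton.2 (key _ g hg le_rfl)

/-- A prime ideal of a polynomial ring over a field is principal if it contains no nonzero
polynomial free of the variable `x`. -/
theorem MvPolynomial.exists_eq_span_singleton_of_rename {σ K : Type*} [Field K] [DecidableEq σ]
    (x : σ) (I : Ideal (MvPolynomial σ K)) [hI : I.IsPrime]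
    (h : ∀ R : MvPolynomial {s // s ≠ x} K, MvPolynomial.rename Subtype.val R ∈ I → R = 0) :
    ∃ p, I = Ideal.span {p} := by
  let e : MvPolynomial σ K ≃ₐ[K] Polynomial (MvPolynomial {s // s ≠ x} K) :=
    (MvPolynomial.renameEquiv K (Equiv.optionSubtypeNe x).symm).trans
      (MvPolynomial.optionEquivLeft K _)
  have he : ∀ R : MvPolynomial {s // s ≠ x} K,
      e (MvPolynomial.rename Subtype.val R) = Polynomial.C R := by
    intro R
    induction R using MvPolynomial.induction_on with
    | C a => simp [e]
    | add p q hp hq => rw [map_add, map_add, hp, hq, Polynomial.C_add]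
    | mul_X p s hp =>
      rw [map_mul, map_mul, hp, Polynomial.C_mul]
      simp [e, s.2]
  obtain ⟨p, hp⟩ := Polynomial.exists_eq_span_singleton_of_comap_C_eq_bot
    (I.comap e.symm.toRingHom) (fun a ha => h a (by
      rw [Ideal.mem_comap, ← he] at ha
      simpa using ha))
  refine ⟨e.symm p, ?_⟩
  have h1 : (I.comap e.symm.toRingHom).comap e.toRingHom = I := by
    ext g; simp [Ideal.mem_comap]
  rw [← h1, hp]
  ext g
  rw [Ideal.mem_comap, Ideal.mem_span_singleton, Ideal.mem_span_singleton]
  constructor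
  · intro hd
    have := map_dvd e.symm hd
    simpa using this
  · intro hd
    have := map_dvd e hd
    simpa using this

/-- A polynomial of degree at most `k` that vanishes at all points with at most `k` nonzero
coordinates is zero. -/
theorem MvPolynomial.eq_zero_of_totalDegree_le_of_eval_eq_zero {σ K : Type*} [Field K] [Infinite K]
    (k : ℕ) (P : MvPolynomial σ K) (hP : P.totalDegree ≤ k)
    (h : ∀ (T : Finset σ) (t : σ → K), T.card ≤ k → (∀ i ∉ T, t i = 0) → eval t P = 0) :
    P = 0 := by
  classical
  ext m
  rw [coeff_zero]
  by_contra hm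
  have hmem : m ∈ P.support := mem_support_iff.2 hm
  have hcard : m.support.card ≤ k := by
    refine le_trans ?_ ((le_totalDegree hmem).trans hP)
    rw [Finsupp.sum, Finset.card_eq_sum_ones]
    exact Finset.sum_le_sum fun i hi => Nat.one_le_iff_ne_zero.2 (Finsupp.mem_support_iff.1 hi)
  let f : σ → MvPolynomial σ K := fun i => if i ∈ m.support then X i else 0
  have hz : aeval f P = 0 := by
    apply funext
    intro t
    rw [map_zero, ← h m.support (fun i => if i ∈ m.support then t i else 0) hcard
      (fun i hi => if_neg hi)]
    rw [aeval_def, ← eval₂_id P, ← coe_eval₂Hom, ← coe_eval₂Hom, ← RingHom.comp_apply]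
    congr 1
    ext i
    · simp
    · simp only [f, RingHom.comp_apply, coe_eval₂Hom, eval₂_X]
      split_ifs <;> simp
  have hc : coeff m (aeval f P) = coeff m P := by
    rw [P.as_sum, map_sum, coeff_sum, coeff_sum]
    refine Finset.sum_congr rfl fun d _ => ?_
    rw [aeval_monomial, coeff_monomial]
    by_cases hd : d.support ⊆ m.support
    · have : (d.prod fun i e => f i ^ e) = d.prod fun i e => (X i : MvPolynomial σ K) ^ e := by
        refine Finset.prod_congr rfl fun i hi => ?_
        simp only [f, if_pos (hd hi)]
      rw [this, algebraMap_eq, ← monomial_eq, coeff_monomial]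
    · obtain ⟨i, hi, him⟩ := Finset.not_subset.1 hd
      have : (d.prod fun i e => f i ^ e) = 0 := by
        refine Finset.prod_eq_zero hi ?_
        simp only [f, if_neg him]
        exact zero_pow (Finsupp.mem_support_iff.1 hi)
      rw [this, mul_zero, coeff_zero, if_neg]
      rintro rfl
      exact hd subset_rfl
  exact hm (by rw [← hc, hz, coeff_zero])

theorem MvPolynomial.pderiv_aeval {σ τ K : Type*} [Fintype σ] [CommRing K]
    (φ : σ → MvPolynomial τ K) (t : τ) (R : MvPolynomial σ K) :
    pderiv t (aeval φ R) = ∑ s, aeval φ (pderiv s R) * pderiv t (φ s) := by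
  classical
  induction R using MvPolynomial.induction_on with
  | C a => simp
  | add p q hp hq => simp only [map_add, hp, hq, add_mul, Finset.sum_add_distrib]
  | mul_X p s hp =>
    simp only [map_mul, aeval_X, Derivation.leibniz, smul_eq_mul, hp, map_add, pderiv_X, add_mul,
      Finset.sum_add_distrib]
    congr 1
    · rw [Finset.sum_eq_single s]
      · simp
      · intro b _ hb
        simp [hb]
      · simp
    · rw [Finset.mul_sum]
      exact Finset.sum_congr rfl fun i _ => by rw [mul_assoc]

theorem MvPolynomial.eq_C_of_pderiv_eq_zero {σ K : Type*} [Field K] [CharZero K]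
    (R : MvPolynomial σ K) (h : ∀ s, pderiv s R = 0) : R = C (coeff 0 R) := by
  classical
  ext m
  rw [coeff_C]
  split_ifs with hm
  · rw [hm]
  · obtain ⟨s, hs⟩ : ∃ s, m s ≠ 0 := by
      by_contra! hc
      exact hm (Finsupp.ext fun s => (hc s).symm)
    have h1 := congrArg (coeff (m - Finsupp.single s 1)) (h s)
    have hle : Finsupp.single s 1 ≤ m :=
      Finsupp.single_le_iff.2 (Nat.one_le_iff_ne_zero.2 hs)
    rw [coeff_pderiv, tsub_add_cancel_of_le hle, coeff_zero] at h1
    refine (mul_eq_zero.1 h1).resolve_right ?_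
    rw [← Nat.cast_succ]
    exact Nat.cast_ne_zero.2 (Nat.succ_ne_zero _)

/-- **Jacobian criterion**: a family of polynomials is algebraically independent if its Jacobian
matrix has a right inverse, up to an invertible diagonal matrix, at some point. -/
theorem MvPolynomial.eq_zero_of_aeval_eq_zero_of_jacobian {σ τ K : Type*} [Fintype σ] [Fintype τ]
    [Field K] [CharZero K] (φ : σ → MvPolynomial τ K) (u : τ → K)
    (N : τ → σ → K) (d : σ → K) (hd : ∀ s, d s ≠ 0)
    (h : ∀ s s', s ≠ s' → ∑ t, eval u (pderiv t (φ s)) * N t s' = 0)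
    (h' : ∀ s, ∑ t, eval u (pderiv t (φ s)) * N t s = d s)
    (R : MvPolynomial σ K) (hR : aeval φ R = 0) : R = 0 := by
  classical
  let J : Matrix σ τ (MvPolynomial τ K) := Matrix.of fun s t => pderiv t (φ s)
  have hinj : ∀ v : σ → MvPolynomial τ K, Matrix.vecMul v J = 0 → v = 0 := by
    intro v hv
    let N' : Matrix τ σ (MvPolynomial τ K) := Matrix.of fun t s => C (N t s)
    let M : Matrix σ σ (MvPolynomial τ K) := J * N'
    have hM : M.map (eval u) = Matrix.diagonal d := by
      ext s s'
      have : (M.map (eval u)) s s' = ∑ t, eval u (pderiv t (φ s)) * N t s' := by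
        rw [Matrix.map_apply, show M s s' = ∑ t, J s t * N' t s' from Matrix.mul_apply, map_sum]
        exact Finset.sum_congr rfl fun t _ => by simp [J, N']
      rw [this, Matrix.diagonal_apply]
      split_ifs with hs
      · rw [← hs, h' s]
      · exact h s s' hs
    refine Matrix.eq_zero_of_vecMul_eq_zero (M := M) ?_ ?_
    · intro h0
      have h1 := RingHom.map_det (eval u) M
      rw [h0, map_zero, RingHom.mapMatrix_apply, hM, Matrix.det_diagonal] at h1
      exact Finset.prod_ne_zero_iff.2 (fun s _ => hd s) h1.symm
    · rw [show M = J * N' from rfl, ← Matrix.vecMul_vecMul, hv, Matrix.zero_vecMul]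
  by_contra hR0
  have hex : ∃ n, ∃ R : MvPolynomial σ K, R ≠ 0 ∧ aeval φ R = 0 ∧ R.totalDegree = n :=
    ⟨_, R, hR0, hR, rfl⟩
  obtain ⟨Q, hQ0, hQ, hQn⟩ := Nat.find_spec hex
  have h1 : (fun s => aeval φ (pderiv s Q)) = 0 := by
    apply hinj
    funext t
    have := pderiv_aeval φ t Q
    rw [hQ, map_zero] at this
    exact this.symm
  have h2 : ∀ s, pderiv s Q = 0 := by
    intro s
    by_contra hs
    refine Nat.find_min hex (m := (pderiv s Q).totalDegree) ?_
      ⟨pderiv s Q, hs, congrFun h1 s, rfl⟩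
    rw [← hQn]
    obtain ⟨m, hm, hmd⟩ := Finset.exists_mem_eq_sup (pderiv s Q).support
      (support_nonempty.2 hs) fun m => m.sum fun _ e => e
    rw [totalDegree, hmd]
    rw [mem_support_iff, coeff_pderiv] at hm
    have := le_totalDegree (mem_support_iff.2 (left_ne_zero_of_mul hm))
    rw [Finsupp.sum_add_index' (fun _ => rfl) (fun _ _ _ => rfl), Finsupp.sum_single_index rfl]
      at this
    omega
  have h3 := eq_C_of_pderiv_eq_zero Q h2
  rw [h3, algHom_C, algebraMap_eq, C_eq_zero] at hQ
  rw [hQ, C_0] at h3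
  exact hQ0 h3

theorem MvPolynomial.totalDegree_aeval_le {σ τ K : Type*} [CommRing K] (f : σ → MvPolynomial τ K)
    (hf : ∀ s, (f s).totalDegree ≤ 1) (P : MvPolynomial σ K) :
    (aeval f P).totalDegree ≤ P.totalDegree := by
  rw [aeval_def, eval₂_eq]
  refine totalDegree_finsetSum_le fun m hm => ?_
  refine (totalDegree_mul _ _).trans ?_
  rw [algebraMap_eq, totalDegree_C, zero_add]
  refine (totalDegree_finsetProd _ _).trans (le_trans ?_ (le_totalDegree hm))
  refine Finset.sum_le_sum fun i _ => (totalDegree_pow _ _).trans ?_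
  exact (Nat.mul_le_mul_left _ (hf i)).trans_eq (mul_one _)

namespace SecantInvariant

/-- The symmetric tensor `u ⊗ ⋯ ⊗ u`. -/
def powTensor {n : ℕ} (d : ℕ) {K : Type*} [CommMonoid K] (u : Fin (n + 1) → K)
    (s : Sym (Fin (n + 1)) d) : K :=
  ((s : Multiset (Fin (n + 1))).map u).prod

theorem powTensor_eq_prod_pow {n d : ℕ} {K : Type*} [CommMonoid K] (u : Fin (n + 1) → K)
    (s : Sym (Fin (n + 1)) d) :
    powTensor d u s = ∏ i, u i ^ (s : Multiset (Fin (n + 1))).count i := by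
  rw [powTensor, Finset.prod_multiset_map_count]
  refine Finset.prod_subset (Finset.subset_univ _) fun i _ hi => ?_
  rw [Multiset.mem_toFinset] at hi
  rw [Multiset.count_eq_zero_of_notMem hi, pow_zero]

theorem powTensor_smul {n d : ℕ} {K : Type*} [CommMonoid K] (a : K) (u : Fin (n + 1) → K)
    (s : Sym (Fin (n + 1)) d) : powTensor d (fun i => a * u i) s = a ^ d * powTensor d u s := by
  rw [powTensor, powTensor, Multiset.prod_map_mul, Multiset.map_const', Multiset.prod_replicate,
    Sym.card_coe]

theorem map_powTensor {n d : ℕ} {K L : Type*} [CommMonoid K] [CommMonoid L] (f : K →* L)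
    (u : Fin (n + 1) → K) (s : Sym (Fin (n + 1)) d) :
    f (powTensor d u s) = powTensor d (fun i => f (u i)) s := by
  rw [powTensor, map_multiset_prod, Multiset.map_map]
  rfl

/-- The linear form with coefficients `u`. -/
def linForm {n : ℕ} (u : Fin (n + 1) → ℂ) : MvPolynomial (Fin (n + 1)) ℂ :=
  ∑ i, u i • MvPolynomial.X i

theorem linForm_isHomogeneous {n : ℕ} (u : Fin (n + 1) → ℂ) : (linForm u).IsHomogeneous 1 := by
  refine MvPolynomial.IsHomogeneous.sum _ _ _ fun i _ => ?_
  rw [MvPolynomial.smul_eq_C_mul]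
  exact (MvPolynomial.isHomogeneous_X ℂ i).C_mul (u i)

theorem tensorEntry_add {n d : ℕ} (F G : MvPolynomial (Fin (n + 1)) ℂ) :
    tensorEntry d (F + G) = tensorEntry d F + tensorEntry d G := by
  funext s
  simp [tensorEntry, add_div]

theorem tensorEntry_smul {n d : ℕ} (a : ℂ) (F : MvPolynomial (Fin (n + 1)) ℂ) :
    tensorEntry d (a • F) = a • tensorEntry d F := by
  funext s
  simp [tensorEntry, mul_div_assoc]

/-- The symmetric tensor of a form, as a linear map. -/
def tensorLinear (n d : ℕ) : MvPolynomial (Fin (n + 1)) ℂ →ₗ[ℂ] (Sym (Fin (n + 1)) d → ℂ) where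
  toFun := tensorEntry d
  map_add' := tensorEntry_add
  map_smul' := tensorEntry_smul

theorem tensorLinear_apply {n d : ℕ} (F : MvPolynomial (Fin (n + 1)) ℂ) :
    tensorLinear n d F = tensorEntry d F := rfl

theorem multinomial_count_ne_zero {n d : ℕ} (s : Sym (Fin (n + 1)) d) :
    (Nat.multinomial Finset.univ
      (fun i : Fin (n + 1) => Multiset.count i (s : Multiset (Fin (n + 1)))) : ℂ) ≠ 0 :=
  Nat.cast_ne_zero.2 (Nat.multinomial_pos _ _).ne'

theorem tensorEntry_linForm_pow {n d : ℕ} (u : Fin (n + 1) → ℂ) :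
    tensorEntry d (linForm u ^ d) = powTensor d u := by
  funext s
  have hs : (Multiset.toFinsupp (s : Multiset (Fin (n + 1)))).sum (fun _ m => m) = d := by
    rw [show (Multiset.toFinsupp (s : Multiset (Fin (n + 1)))).sum (fun _ m => m) = _ from
      (Finsupp.card_toMultiset _).symm, Multiset.toFinsupp_toMultiset, Sym.card_coe]
  rw [tensorEntry, linForm, MvPolynomial.coeff_linearCombination_X_pow_of_fintype, if_pos hs,
    powTensor_eq_prod_pow, div_eq_iff (multinomial_count_ne_zero s), mul_comm]
  congr 1
  · rw [Finsupp.prod_fintype _ _ (fun _ => pow_zero _)]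
    rfl
  · rw [← Finsupp.multinomial_of_support_subset (Finset.subset_univ _)]
    rfl

theorem tensorEntry_injOn {n d : ℕ} {F G : MvPolynomial (Fin (n + 1)) ℂ} (hF : F.IsHomogeneous d)
    (hG : G.IsHomogeneous d) (h : tensorEntry d F = tensorEntry d G) : F = G := by
  ext m
  by_cases hm : m.degree = d
  · have hc : Multiset.card (Finsupp.toMultiset m) = d := by
      rw [Finsupp.card_toMultiset]; exact hm
    obtain ⟨s, hs⟩ : ∃ s : Sym (Fin (n + 1)) d,
        (s : Multiset (Fin (n + 1))) = Finsupp.toMultiset m := ⟨Sym.mk _ hc, rfl⟩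
    have := congrFun h s
    rw [tensorEntry, tensorEntry, div_left_inj' (multinomial_count_ne_zero _), hs] at this
    simpa using this
  · rw [hF.coeff_eq_zero hm, hG.coeff_eq_zero hm]

/-- Over an infinite field, the tensors `u ⊗ ⋯ ⊗ u` span the symmetric tensors. -/
theorem span_powTensor (n d : ℕ) :
    Submodule.span ℂ (Set.range fun u : Fin (n + 1) → ℂ => powTensor d u) = ⊤ := by
  classical
  by_contra hne
  obtain ⟨f, hf, hle⟩ := Submodule.exists_le_ker_of_lt_top _ (lt_top_iff_ne_top.2 hne)
  apply hf
  let W : MvPolynomial (Fin (n + 1)) ℂ :=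
    ∑ s : Sym (Fin (n + 1)) d, MvPolynomial.monomial (Multiset.toFinsupp (s : Multiset (Fin (n + 1))))
      (f (Pi.single s 1))
  have hfs : ∀ v, f v = ∑ s, v s * f (Pi.single s 1) := by
    intro v
    conv_lhs => rw [← Finset.univ_sum_single v]
    rw [map_sum]
    refine Finset.sum_congr rfl fun s _ => ?_
    rw [← smul_eq_mul, ← map_smul, ← Pi.single_smul, smul_eq_mul, mul_one]
  have hW : W = 0 := by
    apply MvPolynomial.funext
    intro u
    have h0 : f (powTensor d u) = 0 := hle (Submodule.subset_span ⟨u, rfl⟩)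
    rw [map_zero, ← h0, hfs, map_sum]
    refine Finset.sum_congr rfl fun s _ => ?_
    rw [MvPolynomial.eval_monomial, powTensor_eq_prod_pow, mul_comm]
    congr 1
    rw [Finsupp.prod_fintype _ _ (fun _ => pow_zero _)]
    simp
  apply LinearMap.ext
  intro v
  rw [hfs, LinearMap.zero_apply]
  refine Finset.sum_eq_zero fun s _ => ?_
  have : f (Pi.single s 1) = 0 := by
    have := congrArg (MvPolynomial.coeff (Multiset.toFinsupp (s : Multiset (Fin (n + 1))))) hW
    rw [MvPolynomial.coeff_sum, MvPolynomial.coeff_zero, Finset.sum_eq_single s] at this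
    · rwa [MvPolynomial.coeff_monomial, if_pos rfl] at this
    · intro t _ hts
      rw [MvPolynomial.coeff_monomial, if_neg]
      intro h
      exact hts (Sym.coe_injective (Multiset.toFinsupp.injective h))
    · simp
  rw [this, mul_zero]

theorem exists_eq_sum_powTensor {n d : ℕ} (f : Sym (Fin (n + 1)) d → ℂ) :
    ∃ (C : Finset (Fin (n + 1) → ℂ)) (lam : (Fin (n + 1) → ℂ) → ℂ),
      f = ∑ u ∈ C, lam u • powTensor d u := by
  have : f ∈ Submodule.span ℂ (Set.range fun u : Fin (n + 1) → ℂ => powTensor d u) := by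
    rw [span_powTensor]; trivial
  obtain ⟨c, hc⟩ := Finsupp.mem_span_range_iff_exists_finsupp.1 this
  exact ⟨c.support, c, hc.symm⟩

theorem exists_eq_sum_linForm_pow {n d : ℕ} {F : MvPolynomial (Fin (n + 1)) ℂ}
    (hF : F.IsHomogeneous d) :
    ∃ (C : Finset (Fin (n + 1) → ℂ)) (lam : (Fin (n + 1) → ℂ) → ℂ),
      F = ∑ u ∈ C, lam u • linForm u ^ d := by
  obtain ⟨C, lam, h⟩ := exists_eq_sum_powTensor (tensorEntry d F)
  refine ⟨C, lam, tensorEntry_injOn hF ?_ ?_⟩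
  · refine MvPolynomial.IsHomogeneous.sum _ _ _ fun u _ => ?_
    rw [MvPolynomial.smul_eq_C_mul]
    simpa using ((linForm_isHomogeneous u).pow d).C_mul (lam u)
  · rw [h, ← tensorLinear_apply, map_sum]
    refine Finset.sum_congr rfl fun u _ => ?_
    rw [map_smul, tensorLinear_apply, tensorEntry_linForm_pow]

theorem substitute_linForm {n : ℕ} (g : Matrix (Fin (n + 1)) (Fin (n + 1)) ℂ)
    (u : Fin (n + 1) → ℂ) : substitute g (linForm u) = linForm (Matrix.vecMul u g) := by
  simp only [substitute, linForm, map_sum, map_smul, MvPolynomial.bind₁_X_right, Matrix.vecMul,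
    dotProduct, Finset.smul_sum, Finset.sum_smul]
  rw [Finset.sum_comm]
  refine Finset.sum_congr rfl fun j _ => Finset.sum_congr rfl fun i _ => ?_
  rw [← MvPolynomial.smul_eq_C_mul, smul_smul]

theorem tensorEntry_sum_linForm_pow {n d : ℕ} {C : Type*} [Fintype C] (lam : C → ℂ)
    (w : C → Fin (n + 1) → ℂ) :
    tensorEntry d (∑ c, lam c • linForm (w c) ^ d) =
      fun s => ∑ c, lam c * powTensor d (w c) s := by
  rw [← tensorLinear_apply, map_sum]
  funext s
  simp only [map_smul, tensorLinear_apply, tensorEntry_linForm_pow, Finset.sum_apply,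
    Pi.smul_apply, smul_eq_mul]

theorem evalAt_eq_aeval {n d : ℕ} (P : CoeffRing n d) (F : MvPolynomial (Fin (n + 1)) ℂ) :
    evalAt P F = MvPolynomial.aeval (tensorEntry d F) P := by
  rw [evalAt, ← MvPolynomial.coe_aeval_eq_eval]
  rfl

theorem det_eq_sum_epsilon {m : ℕ} {K : Type*} [CommRing K] (M : Matrix (Fin m) (Fin m) K) :
    M.det = ∑ i : Fin m → Fin m, (epsilon i : K) * ∏ l, M l (i l) := by
  classical
  rw [← Matrix.det_transpose, Matrix.det_apply']
  symm
  rw [← Finset.sum_filter_add_sum_filter_not Finset.univ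
    (fun i : Fin m → Fin m => Function.Bijective i)]
  rw [add_eq_left.2 (Finset.sum_eq_zero fun i hi => by
    rw [epsilon, dif_neg (Finset.mem_filter.1 hi).2, Int.cast_zero, zero_mul])]
  refine (Finset.sum_bij (fun (σ : Equiv.Perm (Fin m)) _ => (σ : Fin m → Fin m)) ?_ ?_ ?_ ?_).symm
  · exact fun σ _ => Finset.mem_filter.2 ⟨Finset.mem_univ _, σ.bijective⟩
  · exact fun σ _ τ _ h => Equiv.ext (congrFun h)
  · exact fun i hi => ⟨Equiv.ofBijective i (Finset.mem_filter.1 hi).2, Finset.mem_univ _, rfl⟩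
  · intro σ _
    rw [epsilon, dif_pos σ.bijective]
    have : Equiv.ofBijective (σ : Fin m → Fin m) σ.bijective = σ := Equiv.ext fun _ => rfl
    rw [this]
    rfl

namespace BlockHypergraph

variable {A B : Type} [Fintype A] [DecidableEq A] [Fintype B] [DecidableEq B] {n d : ℕ}

/-- The value of the invariant of a hypergraph at a sum of powers of linear forms, as a sum over
the colorings of the vertices by the linear forms. -/
theorem aeval_invariant_sum_powTensor (G : BlockHypergraph A B n d) {K C : Type*} [CommRing K]
    [Algebra ℂ K] [Fintype C] (lam : C → K) (u : C → Fin (n + 1) → K) :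
    MvPolynomial.aeval (fun s => ∑ c, lam c * powTensor d (u c) s) G.invariant =
      ∑ κ : A → C, (∏ v, lam (κ v)) *
        ∏ b, (Matrix.of fun l j => u (κ (G.block b l)) j : Matrix (Fin (n + 1)) _ K).det := by
  classical
  have hpow : ∀ (i : B → Fin (n + 1) → Fin (n + 1)) (v : A) (c : C),
      powTensor d (u c) (G.indicesAt i v) = ∏ p ∈ G.legs v, u c (i p.1 p.2) := by
    intro i v c
    rw [powTensor, Finset.prod]
    simp only [indicesAt, Sym.coe_mk, Multiset.map_map]
    rfl
  have hκ : ∀ (i : B → Fin (n + 1) → Fin (n + 1)) (κ : A → C),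
      ∏ v, ∏ p ∈ G.legs v, u (κ v) (i p.1 p.2) = ∏ b, ∏ l, u (κ (G.block b l)) (i b l) := by
    intro i κ
    rw [← Fintype.prod_prod_type' (fun b l => u (κ (G.block b l)) (i b l)),
      ← Finset.prod_fiberwise Finset.univ (fun p : B × Fin (n + 1) => G.block p.1 p.2)]
    refine Finset.prod_congr rfl fun v _ => Finset.prod_congr rfl fun p hp => ?_
    rw [(Finset.mem_filter.1 hp).2]
  have hdet : ∀ κ : A → C,
      ∏ b, (Matrix.of fun l j => u (κ (G.block b l)) j : Matrix (Fin (n + 1)) _ K).det =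
        ∑ i : B → Fin (n + 1) → Fin (n + 1), (∏ b, (epsilon (i b) : K)) *
          ∏ b, ∏ l, u (κ (G.block b l)) (i b l) := by
    intro κ
    simp only [det_eq_sum_epsilon, Matrix.of_apply]
    rw [Finset.prod_univ_sum, Fintype.piFinset_univ]
    exact Finset.sum_congr rfl fun i _ => Finset.prod_mul_distrib
  rw [invariant, map_sum]
  simp only [map_mul, map_prod, map_intCast, MvPolynomial.aeval_X, hpow, hdet, Finset.mul_sum]
  rw [Finset.sum_comm]
  refine Finset.sum_congr rfl fun i _ => ?_
  rw [Finset.prod_univ_sum, Fintype.piFinset_univ, Finset.mul_sum]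
  refine Finset.sum_congr rfl fun κ _ => ?_
  rw [Finset.prod_mul_distrib, hκ]
  ring

/-- The invariant vanishes at sums of powers of linear forms indexed by `C` if no coloring by `C`
is proper. -/
theorem aeval_invariant_eq_zero (G : BlockHypergraph A B n d) {K C : Type*} [CommRing K]
    [Algebra ℂ K] [Fintype C] (hG : ∀ κ : A → C, ∃ b, ¬ Function.Injective fun l => κ (G.block b l))
    (lam : C → K) (u : C → Fin (n + 1) → K) :
    MvPolynomial.aeval (fun s => ∑ c, lam c * powTensor d (u c) s) G.invariant = 0 := by
  rw [aeval_invariant_sum_powTensor]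
  refine Finset.sum_eq_zero fun κ _ => ?_
  obtain ⟨b, hb⟩ := hG κ
  obtain ⟨l, l', hl, hne⟩ : ∃ l l', κ (G.block b l) = κ (G.block b l') ∧ l ≠ l' := by
    simpa [Function.Injective] using hb
  rw [Finset.prod_eq_zero (Finset.mem_univ b), mul_zero]
  refine Matrix.det_zero_of_row_eq hne ?_
  funext j
  simp [hl]

theorem invariant_isHomogeneous (G : BlockHypergraph A B n d) :
    G.invariant.IsHomogeneous (Fintype.card A) := by
  refine MvPolynomial.IsHomogeneous.sum _ _ _ fun i _ => ?_
  have h1 : (∏ b : B, ((epsilon (i b) : ℤ) : CoeffRing n d)) =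
      MvPolynomial.C (∏ b : B, ((epsilon (i b) : ℤ) : ℂ)) := by
    rw [map_prod]; simp
  rw [h1]
  refine MvPolynomial.IsHomogeneous.C_mul ?_ _
  have := MvPolynomial.IsHomogeneous.prod Finset.univ
    (fun v : A => (MvPolynomial.X (G.indicesAt i v) : CoeffRing n d)) (fun _ => 1)
    (fun v _ => MvPolynomial.isHomogeneous_X ℂ _)
  simpa using this

/-- The invariant of a hypergraph is a relative invariant of the general linear group. -/
theorem evalAt_invariant_substitute (G : BlockHypergraph A B n d)
    (g : Matrix (Fin (n + 1)) (Fin (n + 1)) ℂ) {F : MvPolynomial (Fin (n + 1)) ℂ}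
    (hF : F.IsHomogeneous d) :
    evalAt G.invariant (substitute g F) = g.det ^ Fintype.card B * evalAt G.invariant F := by
  obtain ⟨C, lam, rfl⟩ := exists_eq_sum_linForm_pow hF
  have key : ∀ w : C → Fin (n + 1) → ℂ,
      evalAt G.invariant (∑ c : C, lam c • linForm (w c) ^ d) =
        MvPolynomial.aeval (fun s => ∑ c : C, lam c * powTensor d (w c) s) G.invariant := by
    intro w
    rw [evalAt_eq_aeval, tensorEntry_sum_linForm_pow]
  have hs : substitute g (∑ u ∈ C, lam u • linForm u ^ d) =
      ∑ c : C, lam c • linForm (Matrix.vecMul (c : Fin (n + 1) → ℂ) g) ^ d := by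
    rw [Finset.sum_coe_sort C fun u => lam u • linForm (Matrix.vecMul u g) ^ d]
    conv_lhs => rw [substitute, map_sum]
    refine Finset.sum_congr rfl fun u _ => ?_
    rw [map_smul, map_pow]
    congr 2
    exact substitute_linForm g u
  rw [hs, key, ← Finset.sum_coe_sort C fun u => lam u • linForm u ^ d, key fun c => c,
    aeval_invariant_sum_powTensor, aeval_invariant_sum_powTensor, Finset.mul_sum]
  refine Finset.sum_congr rfl fun κ _ => ?_
  rw [mul_left_comm]
  congr 1
  rw [← Finset.card_univ, ← Finset.prod_const, ← Finset.prod_mul_distrib]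
  refine Finset.prod_congr rfl fun b _ => ?_
  rw [mul_comm, ← Matrix.det_mul]
  rfl

end BlockHypergraph

/-- The substitution of a sum of `k` general powers of linear forms. -/
def secantParam (k d n : ℕ) : CoeffRing n d →ₐ[ℂ] MvPolynomial (Fin k × Fin (n + 1)) ℂ :=
  MvPolynomial.aeval fun s => ∑ c, powTensor d (fun i => MvPolynomial.X (c, i)) s

/-- The ideal of the polynomials that vanish at all sums of `k` powers of linear forms. -/
def secantIdeal (k d n : ℕ) : Ideal (CoeffRing n d) := RingHom.ker (secantParam k d n)

instance (k d n : ℕ) : (secantIdeal k d n).IsPrime := RingHom.ker_isPrime _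

theorem eval_secantParam {k d n : ℕ} (P : CoeffRing n d) (u : Fin k → Fin (n + 1) → ℂ) :
    MvPolynomial.eval (fun p => u p.1 p.2) (secantParam k d n P) =
      MvPolynomial.aeval (fun s => ∑ c, powTensor d (u c) s) P := by
  rw [← MvPolynomial.coe_aeval_eq_eval, RingHom.coe_coe, ← AlgHom.comp_apply]
  congr 1
  refine MvPolynomial.algHom_ext fun s => ?_
  rw [AlgHom.comp_apply, secantParam, MvPolynomial.aeval_X, MvPolynomial.aeval_X, map_sum]
  refine Finset.sum_congr rfl fun c _ => ?_
  have := map_powTensor (d := d) ((MvPolynomial.aeval (R := ℂ) fun p : Fin k × Fin (n + 1) =>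
    u p.1 p.2) : MvPolynomial (Fin k × Fin (n + 1)) ℂ →* ℂ)
    (fun i => (MvPolynomial.X (c, i) : MvPolynomial (Fin k × Fin (n + 1)) ℂ)) s
  simpa using this

theorem mem_secantIdeal_iff {k d n : ℕ} {P : CoeffRing n d} :
    P ∈ secantIdeal k d n ↔ ∀ u : Fin k → Fin (n + 1) → ℂ,
      MvPolynomial.aeval (fun s => ∑ c, powTensor d (u c) s) P = 0 := by
  rw [secantIdeal, RingHom.mem_ker]
  constructor
  · intro h u
    rw [← eval_secantParam]
    exact (congrArg _ h).trans (map_zero _)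
  · intro h
    apply MvPolynomial.funext
    intro x
    rw [map_zero, ← h fun c i => x (c, i), ← eval_secantParam]

theorem aeval_eq_zero_of_mem_secantIdeal {k d n : ℕ} (hd : d ≠ 0) {P : CoeffRing n d}
    (hP : P ∈ secantIdeal k d n) (lam : Fin k → ℂ) (u : Fin k → Fin (n + 1) → ℂ) :
    MvPolynomial.aeval (fun s => ∑ c, lam c * powTensor d (u c) s) P = 0 := by
  choose r hr using fun c => IsAlgClosed.exists_pow_nat_eq (lam c) (Nat.pos_of_ne_zero hd)
  rw [← mem_secantIdeal_iff.1 hP fun c i => r c * u c i]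
  congr 2
  funext s
  exact Finset.sum_congr rfl fun c _ => by rw [powTensor_smul, hr]

theorem exists_eq_linForm {n : ℕ} (L : Form n 1) :
    ∃ u, (L : MvPolynomial (Fin (n + 1)) ℂ) = linForm u := by
  obtain ⟨C, lam, h⟩ := exists_eq_sum_linForm_pow ((MvPolynomial.mem_homogeneousSubmodule 1 _).1 L.2)
  refine ⟨∑ u ∈ C, lam u • u, ?_⟩
  rw [h]
  simp only [pow_one, linForm, Finset.sum_apply, Pi.smul_apply, smul_eq_mul, Finset.sum_smul,
    Finset.smul_sum, smul_smul]
  rw [Finset.sum_comm]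

theorem evalAt_smul {n d m : ℕ} {P : CoeffRing n d} (hP : P.IsHomogeneous m) (a : ℂ)
    (F : MvPolynomial (Fin (n + 1)) ℂ) : evalAt P (a • F) = a ^ m * evalAt P F := by
  rw [evalAt, evalAt, tensorEntry_smul, MvPolynomial.eval_eq, MvPolynomial.eval_eq, Finset.mul_sum]
  refine Finset.sum_congr rfl fun e he => ?_
  have hdeg : ∑ i ∈ e.support, e i = m := by
    by_contra hne
    exact MvPolynomial.mem_support_iff.1 he (hP.coeff_eq_zero hne)
  simp only [Pi.smul_apply, smul_eq_mul, mul_pow, Finset.prod_mul_distrib, Finset.prod_pow_eq_pow_sum,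
    hdeg]
  ring

theorem vanishesOn_of_mem_secantIdeal {k d n : ℕ} (hd : d ≠ 0) {P : CoeffRing n d}
    (hP : P ∈ secantIdeal k d n) : VanishesOn P (unionOfSpans k (veronese n d)) := by
  rintro p ⟨q, hq, hp⟩
  choose L hL hqL using hq
  choose u hu using fun i => exists_eq_linForm (L i)
  have hmem : p.rep ∈ ⨆ i, (q i).submodule := hp (by
    rw [Projectivization.submodule_eq]
    exact Submodule.mem_span_singleton_self _)
  simp only [hqL, Projectivization.submodule_mk, ← Submodule.span_range_eq_iSup] at hmem
  obtain ⟨lam, hlam⟩ := (Submodule.mem_span_range_iff_exists_fun ℂ).1 hmem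
  have hF : (p.rep : MvPolynomial (Fin (n + 1)) ℂ) = ∑ c, lam c • linForm (u c) ^ d := by
    rw [← hlam, AddSubmonoidClass.coe_finsetSum]
    refine Finset.sum_congr rfl fun c _ => ?_
    rw [← hu]
    rfl
  rw [evalAt_eq_aeval, hF, tensorEntry_sum_linForm_pow]
  exact aeval_eq_zero_of_mem_secantIdeal hd hP lam u

theorem linForm_single_pow_ne_zero {n d : ℕ} : linForm (n := n) (Pi.single 0 1) ^ d ≠ 0 := by
  refine pow_ne_zero _ ?_
  have : linForm (n := n) (Pi.single 0 1) = MvPolynomial.X 0 := by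
    rw [linForm, Finset.sum_eq_single 0] <;> simp +contextual
  rw [this]
  exact MvPolynomial.X_ne_zero 0

theorem mem_secantIdeal_of_vanishesOn {k d n m : ℕ} (hk : k ≠ 0) {P : CoeffRing n d}
    (hm : P.IsHomogeneous m) (hP : VanishesOn P (unionOfSpans k (veronese n d))) :
    P ∈ secantIdeal k d n := by
  classical
  let L : (Fin (n + 1) → ℂ) → Form n 1 := fun u =>
    ⟨linForm u, (MvPolynomial.mem_homogeneousSubmodule 1 _).2 (linForm_isHomogeneous u)⟩
  have hL : ∀ u, (powForm d (L u) : MvPolynomial (Fin (n + 1)) ℂ) = linForm u ^ d := fun _ => rfl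
  have key : ∀ u : Fin k → Fin (n + 1) → ℂ, ∑ c, powForm d (L (u c)) ≠ 0 →
      MvPolynomial.aeval (fun s => ∑ c, powTensor d (u c) s) P = 0 := by
    intro u hF
    have hbase : powForm d (L (Pi.single 0 1)) ≠ 0 := fun h =>
      linForm_single_pow_ne_zero (n := n) (d := d) (by rw [← hL, h]; rfl)
    have hex : ∀ c, ∃ q ∈ veronese n d, powForm d (L (u c)) ∈ q.submodule := by
      intro c
      by_cases hc : powForm d (L (u c)) = 0
      · exact ⟨_, ⟨_, hbase, rfl⟩, by rw [hc]; exact zero_mem _⟩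
      · refine ⟨_, ⟨_, hc, rfl⟩, ?_⟩
        rw [Projectivization.submodule_mk]
        exact Submodule.mem_span_singleton_self _
    choose q hq hqm using hex
    have h0 := hP (Projectivization.mk ℂ _ hF) ⟨q, hq, by
      rw [Projectivization.submodule_mk, Submodule.span_singleton_le_iff_mem]
      exact Submodule.sum_mem _ fun c _ => Submodule.mem_iSup_of_mem c (hqm c)⟩
    obtain ⟨a, ha⟩ := Projectivization.exists_smul_eq_mk_rep ℂ _ hF
    rw [← ha, Units.smul_def, SetLike.val_smul, evalAt_smul hm] at h0
    have h1 := (mul_eq_zero.1 h0).resolve_left (pow_ne_zero _ a.ne_zero)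
    rw [evalAt_eq_aeval, AddSubmonoidClass.coe_finsetSum] at h1
    have h2 := tensorEntry_sum_linForm_pow (d := d) (fun _ => 1) u
    simp only [one_smul, one_mul] at h2
    simp only [hL, h2] at h1
    exact h1
  rw [mem_secantIdeal_iff]
  intro u
  by_cases hF : ∑ c, powForm d (L (u c)) = 0
  · have h1 : (fun s => ∑ c, powTensor d (u c) s) = 0 := by
      have h2 := tensorEntry_sum_linForm_pow (d := d) (fun _ => 1) u
      simp only [one_smul, one_mul] at h2
      rw [← h2]
      have h3 := congrArg (fun F : Form n d => (F : MvPolynomial (Fin (n + 1)) ℂ)) hF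
      simp only [AddSubmonoidClass.coe_finsetSum, hL] at h3
      rw [h3, ← tensorLinear_apply]
      exact map_zero _
    rcases Nat.eq_zero_or_pos m with rfl | hpos
    · obtain ⟨a, rfl⟩ : ∃ a, P = MvPolynomial.C a :=
        ⟨_, MvPolynomial.totalDegree_eq_zero_iff_eq_C.1 (Nat.le_zero.1 hm.totalDegree_le)⟩
      have := key (fun _ => Pi.single 0 1) ?_
      · rw [MvPolynomial.algHom_C] at this ⊢
        exact this
      · rw [Finset.sum_const, Finset.card_univ, Fintype.card_fin]
        refine smul_ne_zero hk fun h => ?_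
        exact linForm_single_pow_ne_zero (n := n) (d := d) (by rw [← hL, h]; rfl)
    · have h2 := evalAt_smul hm 0 0
      rw [zero_pow hpos.ne', zero_mul, smul_zero, evalAt_eq_aeval, ← tensorLinear_apply,
        map_zero] at h2
      rw [h1, h2]
  · exact key u hF

theorem zariskiClosure_subset {n d : ℕ} (S : Set (FormSpace n d)) : S ⊆ zariskiClosure S :=
  fun p hp P _ _ hP q hq => by
    rw [Set.mem_singleton_iff.1 hq]
    exact hP p hp

theorem homogeneousIdeal_zariskiClosure {n d : ℕ} (S : Set (FormSpace n d)) :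
    homogeneousIdeal (zariskiClosure S) = homogeneousIdeal S := by
  unfold homogeneousIdeal
  congr 1
  ext P
  refine and_congr_right fun ⟨m, hm⟩ => ⟨fun h q hq => h q (zariskiClosure_subset S hq), ?_⟩
  exact fun h q hq => hq P m hm h q rfl

/-- If the ideal of the polynomials vanishing at the sums of `k` powers is generated by a
homogeneous polynomial, then this is a defining equation of the secant variety. -/
theorem isDefiningEquation_of_secantIdeal_eq {k d n m : ℕ} (hk : k ≠ 0) (hd : d ≠ 0)
    {P : CoeffRing n d} (hm : P.IsHomogeneous m) (hP : secantIdeal k d n = Ideal.span {P}) :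
    IsDefiningEquation P (secantVariety k d n) := by
  have hmem : P ∈ secantIdeal k d n := hP ▸ Ideal.mem_span_singleton_self P
  have hvan := vanishesOn_of_mem_secantIdeal hd hmem
  refine ⟨fun p => ⟨fun h => h P m hm hvan p rfl, ?_⟩, ?_⟩
  · intro h Q r hQ hQv q hq
    rw [Set.mem_singleton_iff.1 hq]
    have hQm := mem_secantIdeal_of_vanishesOn hk hQ hQv
    rw [hP] at hQm
    obtain ⟨R, rfl⟩ := Ideal.mem_span_singleton.1 hQm
    rw [evalAt, map_mul]
    exact mul_eq_zero_of_left h _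
  · rw [secantVariety, homogeneousIdeal_zariskiClosure]
    refine le_antisymm ?_ ?_
    · rw [homogeneousIdeal, Ideal.span_le, ← hP]
      rintro Q ⟨⟨r, hQ⟩, hQv⟩
      exact mem_secantIdeal_of_vanishesOn hk hQ hQv
    · rw [Ideal.span_le, Set.singleton_subset_iff]
      exact Ideal.subset_span ⟨⟨m, hm⟩, hvan⟩

theorem codimension_eq_one_of_isDefiningEquation {n d : ℕ} {P : CoeffRing n d}
    {S : Set (FormSpace n d)} (h : IsDefiningEquation P S) (hP : Prime P) :
    codimension S = 1 := by
  rw [codimension, h.2]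
  have hprime : (Ideal.span {P}).IsPrime := (Ideal.span_singleton_prime hP.ne_zero).2 hP
  refine le_antisymm ?_ ?_
  · exact Ideal.height_le_one_of_isPrincipal_of_mem_minimalPrimes (Ideal.span {P}) _
      (by rw [Ideal.minimalPrimes_eq_subsingleton_self]; rfl)
  · rw [Order.one_le_iff_pos, pos_iff_ne_zero, Ne, Ideal.height_eq_zero_iff_eq_bot,
      Ideal.span_singleton_eq_bot]
    exact hP.ne_zero

/-- No nonzero polynomial of degree at most `k` vanishes at all sums of `k` powers of linear
forms. -/
theorem lt_totalDegree_of_mem_secantIdeal {k d n : ℕ} (hd : d ≠ 0) {P : CoeffRing n d}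
    (hP : P ∈ secantIdeal k d n) (h0 : P ≠ 0) : k < P.totalDegree := by
  classical
  by_contra hle
  apply h0
  apply MvPolynomial.funext
  intro f
  obtain ⟨C, lam, rfl⟩ := exists_eq_sum_powTensor f
  let Q : MvPolynomial C ℂ := MvPolynomial.aeval (fun s => ∑ u : C,
    MvPolynomial.C (powTensor d (u : Fin (n + 1) → ℂ) s) * MvPolynomial.X u) P
  have hQe : ∀ t : C → ℂ, MvPolynomial.eval t Q =
      MvPolynomial.aeval (fun s => ∑ u : C, t u * powTensor d (u : Fin (n + 1) → ℂ) s) P := by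
    intro t
    rw [← MvPolynomial.coe_aeval_eq_eval, RingHom.coe_coe, ← AlgHom.comp_apply]
    congr 1
    refine MvPolynomial.algHom_ext fun s => ?_
    simp [mul_comm]
  have hQ : Q = 0 := by
    refine MvPolynomial.eq_zero_of_totalDegree_le_of_eval_eq_zero k Q ?_ ?_
    · refine (MvPolynomial.totalDegree_aeval_le _ (fun s => ?_) P).trans (not_lt.1 hle)
      refine MvPolynomial.totalDegree_finsetSum_le fun u _ => ?_
      exact (MvPolynomial.totalDegree_mul _ _).trans (by simp)
    · intro T t hT ht
      obtain ⟨e⟩ : Nonempty (T ↪ Fin k) := by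
        rw [Function.Embedding.nonempty_iff_card_le]
        simpa using hT
      rw [hQe, ← aeval_eq_zero_of_mem_secantIdeal hd hP (Function.extend e (fun u => t u) 0)
        (Function.extend e (fun u => (u : Fin (n + 1) → ℂ)) 0)]
      congr 2
      funext s
      rw [← Fintype.sum_of_injective e e.injective
        (fun u : T => t u * powTensor d (u : Fin (n + 1) → ℂ) s), Finset.sum_coe_sort T
        fun u => t u * powTensor d (u : Fin (n + 1) → ℂ) s]
      · refine (Finset.sum_subset (Finset.subset_univ T) fun u _ hu => ?_).symm
        rw [ht u hu, zero_mul]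
      · intro c hc
        rw [Function.extend_apply' _ _ _ hc, Pi.zero_apply, zero_mul]
      · intro u
        rw [e.injective.extend_apply, e.injective.extend_apply]
  have := hQe fun u => lam u
  rw [hQ, map_zero] at this
  rw [map_zero, this, ← MvPolynomial.coe_aeval_eq_eval, RingHom.coe_coe]
  congr 2
  funext s
  rw [Finset.sum_apply, ← Finset.sum_coe_sort]
  rfl

theorem pderiv_powTensor {C : Type*} [DecidableEq C] {n d : ℕ} (c c' : C) (i : Fin (n + 1))
    (s : Sym (Fin (n + 1)) d) :
    MvPolynomial.pderiv (c, i)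
        (powTensor d (fun j => (MvPolynomial.X (c', j) : MvPolynomial (C × Fin (n + 1)) ℂ)) s) =
      if c' = c then ((s : Multiset (Fin (n + 1))).count i : MvPolynomial (C × Fin (n + 1)) ℂ) *
        (((s : Multiset (Fin (n + 1))).erase i).map fun j => MvPolynomial.X (c', j)).prod
      else 0 := by
  rw [powTensor]
  induction (s : Multiset (Fin (n + 1))) using Multiset.induction_on with
  | empty => simp
  | cons a m ih =>
    rw [Multiset.map_cons, Multiset.prod_cons, MvPolynomial.pderiv_mul, ih]
    split_ifs with hc
    · subst hc
      by_cases hai : a = i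
      · subst hai
        rw [MvPolynomial.pderiv_X_self, Multiset.count_cons_self, Multiset.erase_cons_head]
        by_cases ham : a ∈ m
        · rw [← Multiset.prod_map_erase (f := fun j => (MvPolynomial.X (c', j) :
            MvPolynomial (C × Fin (n + 1)) ℂ)) ham]
          push_cast
          ring
        · rw [Multiset.count_eq_zero_of_notMem ham]
          push_cast
          ring
      · rw [MvPolynomial.pderiv_X_of_ne (by simpa using hai), Multiset.count_cons_of_ne (Ne.symm hai),
          Multiset.erase_cons_tail _ hai, Multiset.map_cons, Multiset.prod_cons]
        ring
    · rw [MvPolynomial.pderiv_X_of_ne (by simp [hc])]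
      ring

/-- Nine points at which the tangent spaces of the Veronese variety are as independent as
possible. -/
def tangentPoints : Fin 9 → Fin 4 → ℤ :=
  ![![1, 0, 0, 0], ![0, 1, 0, 0], ![0, 0, 1, 0], ![0, 0, 0, 1],
    ![0, 1, 1, -1], ![0, 1, 1, 1], ![1, 0, -1, -1], ![1, 0, -1, 1], ![1, 1, 1, 0]]

/-- The entries of the Jacobian matrix of the sum of nine fourth powers, at `tangentPoints`. -/
def tangentJacobian (m : List (Fin 4)) (t : Fin 9 × Fin 4) : ℤ :=
  m.count t.2 * ((m.erase t.2).map (tangentPoints t.1)).prod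

/-- The quartic monomials other than `x_0 ^ 2 * x_3 ^ 2`. -/
def quarticMonomials : List (List (Fin 4)) :=
  [
    [0, 0, 0, 0], [0, 0, 0, 1], [0, 0, 0, 2], [0, 0, 0, 3], [0, 0, 1, 1], [0, 0, 1, 2], [0, 0,
    1, 3], [0, 0, 2, 2], [0, 0, 2, 3], [0, 1, 1, 1], [0, 1, 1, 2], [0, 1, 1, 3], [0, 1, 2, 2],
    [0, 1, 2, 3], [0, 1, 3, 3], [0, 2, 2, 2], [0, 2, 2, 3], [0, 2, 3, 3], [0, 3, 3, 3], [1, 1,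
    1, 1], [1, 1, 1, 2], [1, 1, 1, 3], [1, 1, 2, 2], [1, 1, 2, 3], [1, 1, 3, 3], [1, 2, 2, 2],
    [1, 2, 2, 3], [1, 2, 3, 3], [1, 3, 3, 3], [2, 2, 2, 2], [2, 2, 2, 3], [2, 2, 3, 3], [2, 3,
    3, 3], [3, 3, 3, 3]]

/-- The rows of a right inverse of the Jacobian matrix, up to the factor `12`. -/
def tangentInverse : List (List ((Fin 9 × Fin 4) × ℤ)) :=
  [
    [((0, 0), 3)],
    [((0, 1), 12)],
    [((0, 2), 12)],
    [((0, 3), 12)],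
    [((0, 0), -6), ((0, 1), -18), ((1, 0), -6), ((2, 0), 6), ((2, 1), 6), ((2, 2), 3), ((3, 0),
      -8), ((3, 1), 8), ((3, 2), 16), ((4, 0), -3), ((4, 1), -2), ((4, 2), 1), ((4, 3), -3),
      ((5, 0), -3), ((5, 1), -1), ((5, 2), 2), ((6, 0), 2), ((6, 1), 3), ((6, 2), 1), ((6, 3),
      3), ((7, 0), 1), ((7, 1), 3), ((7, 2), 2), ((8, 0), 3), ((8, 1), 3), ((8, 2), -3)],
    [((0, 1), -6), ((0, 2), -36), ((1, 0), 6), ((2, 0), -18), ((2, 1), -6), ((3, 0), 16), ((3,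
      1), -16), ((3, 2), -32), ((4, 0), 3), ((4, 1), 4), ((4, 2), 1), ((4, 3), 6), ((5, 0), 3),
      ((5, 1), 2), ((5, 2), -1), ((6, 0), -4), ((6, 1), -3), ((6, 2), 1), ((6, 3), -6), ((7, 0),
      -2), ((7, 1), -3), ((7, 2), -1), ((8, 0), 6), ((8, 1), -6)],
    [((0, 3), -36), ((2, 3), -12), ((3, 0), 4), ((3, 1), 4), ((4, 0), 6), ((4, 1), 2), ((4, 2),
      2), ((5, 0), -6), ((5, 1), -2), ((5, 2), -2), ((6, 0), -4), ((6, 2), -2), ((7, 0), 4),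
      ((7, 2), 2), ((8, 3), 12)],
    [((0, 0), -3), ((0, 2), 12), ((2, 0), 12), ((2, 2), -3), ((3, 0), -8), ((3, 2), 8), ((3, 3),
      3), ((6, 0), 2), ((6, 2), -2), ((6, 3), 3), ((7, 0), 1), ((7, 2), -1)],
    [((0, 3), 24), ((2, 3), 12), ((3, 0), 8), ((3, 2), 4), ((6, 0), 4), ((6, 2), 2), ((7, 0),
      -4), ((7, 2), -2)],
    [((1, 0), 12)],
    [((0, 0), 6), ((0, 1), 18), ((0, 2), 24), ((1, 0), -18), ((1, 1), -6), ((1, 2), -12), ((2,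
      0), 18), ((2, 1), 6), ((4, 0), 3), ((4, 2), -3), ((5, 0), 3), ((5, 2), -3), ((6, 1), -3),
      ((6, 2), -3), ((7, 1), -3), ((7, 2), -3), ((8, 0), -6), ((8, 1), 6)],
    [((0, 3), 24), ((1, 3), -12), ((2, 3), 12), ((3, 0), -20), ((3, 1), -20), ((4, 0), -12),
      ((4, 1), -4), ((4, 2), 2), ((5, 0), 12), ((5, 1), 4), ((5, 2), -2), ((6, 0), 2), ((6, 1),
      -6), ((6, 2), -2), ((7, 0), -2), ((7, 1), 6), ((7, 2), 2), ((8, 3), -12)],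
    [((0, 1), -6), ((0, 2), -12), ((1, 0), 6), ((1, 1), 6), ((1, 2), 12), ((2, 0), -30), ((2,
      1), -6), ((3, 1), 16), ((3, 2), 16), ((3, 3), -6), ((4, 0), -3), ((4, 1), -4), ((4, 2),
      -1), ((4, 3), -6), ((5, 0), -3), ((5, 1), -2), ((5, 2), 1), ((6, 1), 3), ((6, 2), 3), ((7,
      1), 3), ((7, 2), 3), ((8, 2), 6)],
    [((0, 3), -36), ((1, 3), 12), ((2, 3), -36), ((3, 0), 4), ((3, 1), 20), ((3, 2), -8), ((4,
      0), 6), ((4, 1), 4), ((4, 2), -2), ((5, 0), -6), ((5, 1), -4), ((5, 2), 2), ((6, 0), -4),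
      ((6, 1), 6), ((6, 2), -2), ((7, 0), 4), ((7, 1), -6), ((7, 2), 2), ((8, 3), 12)],
    [((0, 0), -12), ((0, 1), -12), ((2, 0), -12), ((2, 2), 6), ((3, 0), 16), ((3, 1), -16), ((3,
      2), -32), ((4, 0), 6), ((4, 1), 4), ((4, 2), 4), ((4, 3), 6), ((5, 0), 6), ((5, 1), 2),
      ((5, 2), 2), ((6, 0), 2), ((6, 2), 4), ((6, 3), -6), ((7, 0), 4), ((7, 2), 2), ((8, 0),
      6), ((8, 1), -6), ((8, 2), -6)],
    [((2, 0), 12)],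
    [((0, 3), 12), ((2, 3), 24), ((3, 0), 4), ((3, 2), 8), ((6, 0), 2), ((6, 2), 4), ((7, 0),
      -2), ((7, 2), -4)],
    [((0, 0), 6), ((0, 2), -12), ((2, 0), 12), ((2, 2), -6), ((3, 0), -16), ((3, 2), 16), ((3,
      3), 6), ((6, 0), -2), ((6, 2), -4), ((6, 3), 6), ((7, 0), -4), ((7, 2), -2)],
    [((3, 0), 12)],
    [((1, 1), 3)],
    [((1, 2), 12)],
    [((1, 3), 12)],
    [((1, 1), -3), ((1, 2), -12), ((2, 1), -12), ((2, 2), -3), ((3, 1), -8), ((3, 2), -8), ((3,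
      3), 3), ((4, 1), 2), ((4, 2), 2), ((4, 3), 3), ((5, 1), 1), ((5, 2), 1)],
    [((1, 3), -24), ((2, 3), 12), ((3, 1), -8), ((3, 2), 4), ((4, 1), -4), ((4, 2), 2), ((5, 1),
      4), ((5, 2), -2)],
    [((0, 0), 6), ((0, 2), -12), ((1, 1), -6), ((1, 2), -12), ((2, 0), 12), ((2, 1), 12), ((4,
      1), 3), ((4, 2), -3), ((5, 1), 3), ((5, 2), -3), ((6, 0), -3), ((6, 2), -3), ((7, 0), -3),
      ((7, 2), -3)],
    [((2, 1), 12)],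
    [((1, 3), 12), ((2, 3), -24), ((3, 1), 4), ((3, 2), -8), ((4, 1), 2), ((4, 2), -4), ((5, 1),
      -2), ((5, 2), 4)],
    [((0, 0), -12), ((0, 2), 24), ((1, 1), 6), ((1, 2), 12), ((2, 0), -24), ((2, 1), -12), ((2,
      2), 6), ((3, 1), 16), ((3, 2), 16), ((3, 3), -6), ((4, 1), -4), ((4, 2), 2), ((4, 3), -6),
      ((5, 1), -2), ((5, 2), 4), ((6, 0), 6), ((6, 2), 6), ((7, 0), 6), ((7, 2), 6)],
    [((3, 1), 12)],
    [((2, 2), 3)],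
    [((2, 3), 12)],
    [((0, 0), 6), ((0, 2), -12), ((2, 0), 12), ((2, 2), -6), ((6, 0), -3), ((6, 2), -3), ((7,
      0), -3), ((7, 2), -3)],
    [((3, 2), 12)],
    [((3, 3), 3)]]

theorem tangentJacobian_mul_tangentInverse : ∀ k k' : Fin 34,
    ((tangentInverse.getD k' []).map fun p =>
      tangentJacobian (quarticMonomials.getD k []) p.1 * p.2).sum = if k = k' then 12 else 0 := by
  decide +kernel

theorem quarticMonomials_spec : ∀ a b c d : Fin 4,
    ([a, b, c, d].Perm [0, 0, 3, 3]) ∨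
      ∃ k : Fin 34, [a, b, c, d].Perm (quarticMonomials.getD k []) := by
  decide +kernel

theorem sum_mul_sum_ite {ι : Type*} [Fintype ι] [DecidableEq ι] (f : ι → ℤ) (l : List (ι × ℤ)) :
    ∑ t, f t * (l.map fun p => if p.1 = t then p.2 else 0).sum =
      (l.map fun p => f p.1 * p.2).sum := by
  induction l with
  | nil => simp
  | cons p l ih =>
    simp only [List.map_cons, List.sum_cons, mul_add, Finset.sum_add_distrib, ih]
    congr 1
    simp

/-- The symmetric index `{0, 0, 3, 3}`. -/
def omittedIndex : Sym (Fin 4) 4 := ⟨([0, 0, 3, 3] : List (Fin 4)), rfl⟩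

theorem exists_quarticMonomial (s : Sym (Fin 4) 4) (hs : s ≠ omittedIndex) :
    ∃ k : Fin 34, (s : Multiset (Fin 4)) = (quarticMonomials.getD k [] : List (Fin 4)) := by
  obtain ⟨m, hm⟩ := s
  induction m using Quotient.inductionOn with
  | h l =>
    have hl : l.length = 4 := hm
    obtain ⟨a, b, c, d, rfl⟩ : ∃ a b c d, l = [a, b, c, d] := List.length_eq_four.1 hl
    rcases quarticMonomials_spec a b c d with h | ⟨k, hk⟩
    · exact absurd (Subtype.ext (Quotient.sound h)) hs
    · exact ⟨k, Quotient.sound hk⟩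

/-- A polynomial that vanishes at all sums of nine fourth powers of quaternary linear forms
involves the coefficient of `x_0 ^ 2 * x_3 ^ 2`. -/
theorem eq_zero_of_rename_mem_secantIdeal
    (R : MvPolynomial {s : Sym (Fin 4) 4 // s ≠ omittedIndex} ℂ)
    (hR : MvPolynomial.rename Subtype.val R ∈ secantIdeal 9 4 3) : R = 0 := by
  classical
  choose idx hidx using fun s : {s : Sym (Fin 4) 4 // s ≠ omittedIndex} =>
    exists_quarticMonomial s.1 s.2
  have hinj : ∀ s s', idx s = idx s' → s = s' := fun s s' h =>
    Subtype.ext (Sym.coe_injective (by rw [hidx, hidx, h]))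
  have hjac : ∀ (s : {s : Sym (Fin 4) 4 // s ≠ omittedIndex}) (t : Fin 9 × Fin 4),
      MvPolynomial.eval (fun p : Fin 9 × Fin 4 => (tangentPoints p.1 p.2 : ℂ))
        (MvPolynomial.pderiv t (∑ c, powTensor 4 (fun i =>
          (MvPolynomial.X (c, i) : MvPolynomial (Fin 9 × Fin 4) ℂ)) s.1)) =
        (tangentJacobian (quarticMonomials.getD (idx s) []) t : ℂ) := by
    rintro s ⟨c, i⟩
    rw [map_sum, Finset.sum_eq_single c]
    · rw [pderiv_powTensor, if_pos rfl, hidx, Multiset.coe_count, Multiset.coe_erase,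
        Multiset.map_coe, Multiset.prod_coe, tangentJacobian]
      rw [map_mul, map_natCast, map_list_prod, List.map_map]
      push_cast
      rw [List.map_map]
      congr 3
      funext j
      simp
    · intro c' _ hc'
      rw [pderiv_powTensor, if_neg hc']
    · simp
  have hmul : ∀ s s' : {s : Sym (Fin 4) 4 // s ≠ omittedIndex},
      ∑ t, (tangentJacobian (quarticMonomials.getD (idx s) []) t : ℂ) *
        (((tangentInverse.getD (idx s') []).map fun p => if p.1 = t then p.2 else 0).sum : ℤ) =
        if idx s = idx s' then 12 else 0 := by
    intro s s'
    have h := tangentJacobian_mul_tangentInverse (idx s) (idx s')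
    rw [← sum_mul_sum_ite (fun t => tangentJacobian (quarticMonomials.getD (idx s) []) t)] at h
    have h2 := congrArg (Int.cast : ℤ → ℂ) h
    push_cast at h2
    push_cast
    exact h2
  refine MvPolynomial.eq_zero_of_aeval_eq_zero_of_jacobian
    (fun s : {s : Sym (Fin 4) 4 // s ≠ omittedIndex} => ∑ c, powTensor 4 (fun i =>
      (MvPolynomial.X (c, i) : MvPolynomial (Fin 9 × Fin 4) ℂ)) s.1)
    (fun p => (tangentPoints p.1 p.2 : ℂ))
    (fun t s => (((tangentInverse.getD (idx s) []).map fun p =>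
      if p.1 = t then p.2 else 0).sum : ℤ)) (fun _ => 12) (fun _ => by norm_num) ?_ ?_ R ?_
  · intro s s' hne
    simp only [hjac]
    rw [hmul, if_neg fun h => hne (hinj s s' h)]
  · intro s
    simp only [hjac]
    rw [hmul, if_pos rfl]
  · rw [secantIdeal, RingHom.mem_ker, secantParam, MvPolynomial.aeval_rename] at hR
    exact hR

theorem exists_secantIdeal_eq_span : ∃ p, secantIdeal 9 4 3 = Ideal.span {p} :=
  MvPolynomial.exists_eq_span_singleton_of_rename omittedIndex _ eq_zero_of_rename_mem_secantIdeal

/-- The positive roots of the root system `A_4`, in the basis of four of them. -/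
def rootVector : Fin 10 → Fin 4 → ℤ :=
  ![![1, 0, 0, 0], ![0, 1, 0, 0], ![0, 0, 1, 0], ![0, 0, 0, 1],
    ![1, -1, 0, 0], ![1, 0, -1, 0], ![1, 0, 0, -1],
    ![0, 1, -1, 0], ![0, 1, 0, -1], ![0, 0, 1, -1]]

/-- The determinant of four roots. -/
def rootDet (q : Fin 4 → Fin 10) : ℤ :=
  (Matrix.of fun l j => rootVector (q l) j : Matrix (Fin 4) (Fin 4) ℤ).det

def rootMinor (a b : Fin 10) (i j : Fin 4) : ℤ :=
  rootVector a i * rootVector b j - rootVector a j * rootVector b i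

theorem rootDet_eq (a b c d : Fin 10) : rootDet ![a, b, c, d] =
    rootMinor a b 0 1 * rootMinor c d 2 3 - rootMinor a b 0 2 * rootMinor c d 1 3 +
    rootMinor a b 0 3 * rootMinor c d 1 2 + rootMinor a b 1 2 * rootMinor c d 0 3 -
    rootMinor a b 1 3 * rootMinor c d 0 2 + rootMinor a b 2 3 * rootMinor c d 0 1 := by
  rw [rootDet, Matrix.det_succ_row_zero]
  simp only [Matrix.det_fin_three, Fin.sum_univ_four, Matrix.submatrix_apply, Matrix.of_apply,
    rootMinor]
  simp [Fin.succAbove]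
  ring

/-- The position in the tables `rootDetSupport` and `rootDetNeg` of a quadruple of roots. -/
def tableIndex (a b c d : ℕ) : ℕ :=
  Nat.add (Nat.mul (Nat.add (Nat.mul (Nat.add (Nat.mul a 10) b) 10) c) 10) d

/-- The bits are set at the quadruples of roots with nonzero determinant. -/
def rootDetSupport : ℕ :=
  0xf03c0f1c4711c47e000000000f03c0f1c4711c47e0000f03c000000f64992675920000f03c000000f64992675920000f03c0f03c0078de37b1ec000711c592649e3000001c592000711c592649e3000001c592000711c59d675ec1c471001ec0007e1f992649ec649927b000000000000f03c0f1c4711c47e0000000000000000000000000000000000f03c0f1c4711c47e03c0003c0003c00a92aba92a403c0003c0f0000fb56dab56da03c0003c0003c00a92aba92a41c4001c6a4b56a400071002a41c4001c6abb6aab1c4001c6da1c4001c6a4b56a400071002a41f8001faa4b6aa4a92daa9000000000000f03c0f1c4711c47e000000000f03c0f1c4711c47e000000000000000000000000003c0f0000003c0fcdb39ce73603c0f0000f00000d1f48d234803c0f0000f00000d1f48d23481c47100336d1f47000711c7361c47100339d23481c400003481c47100339d23481c400003481f87e00336d2348cdb48d20000000f03c000000f649926759203c0003c0003c00a92aba9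2a403c0f0000003c0fcdb39ce73600000000000000000000000000000f03c000000f649926759203c0003c0003c00a92aba92a464aa4cd80064aa400192a900064aabce40064aab64800ce592676a4ce400676a4a9339002a464aa4cd80064aa400192a90000000f03c000000f649926759203c0003c0f0000fb56dab56da03c0f0000f00000d1f48d23480000f03c000000f6499267592000000000000000000000000003c0f0000f00000d1f48d234864ad5d1d920034700192b559264adad21920034864800d2000676d5d219d00348b57480034864adad21920034864800d20000000f03c0f03c0078de37b1ec03c0003c0003c00a92aba92a403c0f0000f00000d1f48d234803c0003c0003c00a92aba92a403c0f0000f00000d1f48d2348000000000000000000000000078ea4d1ea4d1c00001e3a92a478eabd22abd200078c00d23487b2a4d22a4d2000a9348000007b2a4d22a4d2000a934800000000711c592649e3000001c5921c4001c6a4b56a400071002a41c47100336d1f47000711c73664aa4cd80064aa400192a900064ad5d1d920034700192b559278ea4d1ea4d1c00001e3a92a40000000000000000000000000000711c592649e3000001c5921c4001c6a4b56a400071002a464aa4cd80064aa400192a9000000711c592649e3000001c5921c4001c6abb6aab1c4001c6da1c47100339d23481c4000034864aabce40064aab64800ce59264adad21920034864800d200078eabd22abd200078c00d2348000711c592649e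3000001c59200000000000000000000000001c47100339d23481c4000034864adad21920034864800d2000000711c59d675ec1c471001ec1c4001c6a4b56a400071002a41c47100339d23481c40000348676a4ce400676a4a9339002a4676d5d219d00348b5748003487b2a4d22a4d2000a9348000001c4001c6a4b56a400071002a41c47100339d23481c4000034800000000000000000000000007b2a4d22a4d2000a9348000000007e1f992649ec649927b0001f8001faa4b6aa4a92daa90001f87e00336d2348cdb48d200064aa4cd80064aa400192a900064adad21920034864800d20007b2a4d22a4d2000a93480000064aa4cd80064aa400192a900064adad21920034864800d20007b2a4d22a4d2000a9348000000000000000000000000000000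

/-- The bits are set at the quadruples of roots with negative determinant. -/
def rootDetNeg : ℕ :=
  0xf03c0f000000000e000000000f03c0f000000000e00000000000000f609826018200000000000000f609826018200000000000000078de3781e0000711c41004000000001c410000711c41004000000001c410000711c41d0740c000000000c000701c0100400c60982780000000000000000001c4711c4700000000000000000000000000000000000f03c0f000000000e03c000000000000280ab280a003c000000f0000f2008a2008a03c000000000000280ab280a0000001c604956040000000204000001c600942001c4001c650000001c604956040000000204038001c204942042808a280000000000000000001c4711c4700000000000000001c4711c470000000000000000000000000003c0f00000000000c0390e43003c0f0000f00000000080200803c0f0000f0000000008020080000000306d1f4700000003060000000300d03401c400003400000000300d03401c400003400380e00306d03400c008020000000f03c000000004010074100000003c0003c008120081204000000000003c0fc1b00c0306000000000000000000000000000000000000000f609826018203c000000000000280ab280a0608a00c000042040018228000608ab0e40004200040000e410600a00e400076048130000204608a00c0000420400182280000000f03c000000004010074100000003c00000009565095650000000000000000d1f40d03400000f03c00000000401007410000000000000000000000000003c0f0000f00000000080200860880001820034700182201826088a0218200340040000200060080021800034095740003406088a021820034004000020000000f03c0f03c00000000300c0000003c0003c008120081204000000000000000d1f40d03400000003c0003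c008120081204000000000000000d1f40d0340000000000000000000000000078ca0000a000000001e3280a078cab020ab020000000002008780a0020a0020008134000000780a0020a00200081340000000000000182609e300000001821c400000a0200a000071000a01c4710003000000000711c43004204c1800608a0000108100004255d1c1000000000109541000204d1e04d1c00000008120400000000000000000000000000000000182609e300000001821c400000a0200a000071000a004204c1800608a000010810000000000182609e300000001821c400000ab228ab000000008a1c4710003902008000000000804200c0000608ab60800c018204250d00100000860800d000000200d0200d000078c00d0340000711c41004000000001c41000000000000000000000000001c4710003902008000000000804250d00100000860800d00000000000180601e01c471001e01c400000a0200a000071000a01c4710003902008000000000807604c0000600a028039000a007655d001d00008200080000803204d0204d00002800800000000001c6049560400000002040000000300d03401c40000340000000000000000000000000003204d0204d000028008000000000e03982609e004010030001c000038a0228a081250810001c0700003002008c1b40d000004204c1800608a0000108100004250d00100000860800d000003204d0204d00002800800000608a00c0000420400182280006088a02182003400400002000780a0020a00200081340000000000000000000000000000000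

def bit (T i : ℕ) : Bool := Nat.beq (Nat.land (Nat.shiftRight T i) 1) 1

/-- The product of `x` and the determinant of four roots. -/
def detMul (a b c d : ℕ) (x : ℤ) : ℤ :=
  bif bit rootDetSupport (tableIndex a b c d) then
    (bif bit rootDetNeg (tableIndex a b c d) then -x else x) else 0

theorem detMul_one : ∀ a b c d : Fin 10, detMul a b c d 1 =
    rootMinor a b 0 1 * rootMinor c d 2 3 - rootMinor a b 0 2 * rootMinor c d 1 3 +
    rootMinor a b 0 3 * rootMinor c d 1 2 + rootMinor a b 1 2 * rootMinor c d 0 3 -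
    rootMinor a b 1 3 * rootMinor c d 0 2 + rootMinor a b 2 3 * rootMinor c d 0 1 := by
  decide +kernel

/-- `0` if `c` is in `l`, and `x` otherwise. -/
def unlessMem (c : ℕ) : List ℕ → ℤ → ℤ
  | [], x => x
  | a :: l, x => bif Nat.beq c a then 0 else unlessMem c l x

def sumTen (f : ℕ → ℤ) : ℤ :=
  f 0 + (f 1 + (f 2 + (f 3 + (f 4 + (f 5 + (f 6 + (f 7 + (f 8 + f 9))))))))

/-- The sum, over the bijections from the vertices of the hypergraph to the roots that map the
first two vertices to `a` and `b`, of the products of the determinants of the blocks. -/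
def rootSum (a b : ℕ) : ℤ :=
  sumTen fun c => unlessMem c [a, b] <|
  sumTen fun d => detMul a b c d <|
  sumTen fun e => unlessMem e [a, b, c, d] <|
  sumTen fun f => detMul b d e f <| unlessMem f [a, c] <|
  sumTen fun g => detMul a e f g <| unlessMem g [b, c, d] <|
  sumTen fun h => detMul c d g h <| unlessMem h [a, b, e, f] <|
  sumTen fun i => detMul a f h i <| detMul b e h i <| unlessMem i [c, d, g] <|
  sumTen fun j => detMul a b g j <| detMul c e i j <| detMul c f h j <| detMul d g i j 1

theorem rootSum_adjacent : rootSum 0 1 = 408 := by decide +kernel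

theorem rootSum_disjoint : rootSum 0 7 = 192 := by decide +kernel

theorem BlockHypergraph.prod_block {A B : Type} [Fintype A] [DecidableEq A] [Fintype B]
    [DecidableEq B] {n d : ℕ} (G : BlockHypergraph A B n d) {K : Type*} [CommMonoid K] (f : A → K) :
    ∏ b, ∏ l, f (G.block b l) = ∏ v, f v ^ d := by
  rw [← Fintype.prod_prod_type' (fun b l => f (G.block b l)),
    ← Finset.prod_fiberwise Finset.univ (fun p : B × Fin (n + 1) => G.block p.1 p.2)]
  refine Finset.prod_congr rfl fun v _ => ?_
  rw [Finset.prod_congr rfl (g := fun _ => f v) fun p hp => by rw [(Finset.mem_filter.1 hp).2],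
    Finset.prod_const, G.regular v]

/-- The product of the determinants of the blocks in a coloring of the vertices by roots. -/
def rootWeight (κ : Fin 10 → Fin 10) : ℤ :=
  ∏ b, rootDet fun l => κ (quarticHypergraph.block b l)

/-- A linear map that permutes the roots up to sign. -/
structure RootSymmetry where
  perm : Equiv.Perm (Fin 10)
  sgn : Fin 10 → ℤ
  mat : Matrix (Fin 4) (Fin 4) ℤ
  sgn_pow : ∀ c, sgn c ^ 4 = 1
  det_pow : mat.det ^ 10 = 1
  map_root : ∀ c j, rootVector (perm c) j = sgn c * ∑ i, rootVector c i * mat i j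

theorem RootSymmetry.rootDet_perm (g : RootSymmetry) (q : Fin 4 → Fin 10) :
    rootDet (fun l => g.perm (q l)) = (∏ l, g.sgn (q l)) * (rootDet q * g.mat.det) := by
  unfold rootDet
  rw [← Matrix.det_mul, ← Matrix.det_mul_column]
  congr 1
  ext l j
  simp only [Matrix.of_apply, g.map_root, Matrix.mul_apply]

theorem RootSymmetry.rootWeight_perm (g : RootSymmetry) (κ : Fin 10 → Fin 10) :
    rootWeight (fun v => g.perm (κ v)) = rootWeight κ := by
  simp only [rootWeight, g.rootDet_perm, Finset.prod_mul_distrib]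
  rw [quarticHypergraph.prod_block fun v => g.sgn (κ v)]
  simp [g.sgn_pow, g.det_pow]

/-- The sum of the weights of the colorings with given colors at the first two vertices. -/
def weightSum (a b : Fin 10) : ℤ :=
  ∑ κ : Fin 8 → Fin 10, rootWeight (Matrix.vecCons a (Matrix.vecCons b κ))

theorem RootSymmetry.weightSum_perm (g : RootSymmetry) (a b : Fin 10) :
    weightSum (g.perm a) (g.perm b) = weightSum a b := by
  unfold weightSum
  rw [← (Equiv.arrowCongr (Equiv.refl (Fin 8)) g.perm).sum_comp]
  refine Finset.sum_congr rfl fun κ _ => ?_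
  rw [← g.rootWeight_perm (Matrix.vecCons a _)]
  congr 1
  funext v
  refine Fin.cases rfl (fun v => Fin.cases rfl (fun v => rfl) v) v

theorem sum_vecCons {α M : Type*} [Fintype α] [AddCommMonoid M] {n : ℕ}
    (F : (Fin (n + 1) → α) → M) : ∑ κ, F κ = ∑ a, ∑ κ, F (Matrix.vecCons a κ) := by
  rw [← (Fin.consEquiv fun _ : Fin (n + 1) => α).sum_comp, Fintype.sum_prod_type]
  rfl

theorem sum_rootWeight : ∑ κ, rootWeight κ = ∑ a, ∑ b, weightSum a b := by
  simp only [sum_vecCons (n := 9), sum_vecCons (n := 8), weightSum]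

theorem sumTen_eq (f : ℕ → ℤ) : sumTen f = ∑ c : Fin 10, f c := by
  simp only [sumTen, Fin.sum_univ_succ, Fin.sum_univ_zero]
  simp

theorem unlessMem_eq (c : ℕ) (l : List ℕ) (x : ℤ) :
    unlessMem c l x = (if c ∈ l then 0 else 1) * x := by
  induction l with
  | nil => simp [unlessMem]
  | cons a l ih =>
    rw [unlessMem, ih]
    by_cases h : c = a
    · subst h; simp
    · cases hb : Nat.beq c a with
      | true => exact absurd (Nat.eq_of_beq_eq_true hb) h
      | false => simp [h]

theorem detMul_eq (a b c d : Fin 10) (x : ℤ) :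
    detMul a b c d x = rootDet ![a, b, c, d] * x := by
  rw [rootDet_eq, ← detMul_one]
  unfold detMul
  cases bit rootDetSupport (tableIndex a b c d) <;> cases bit rootDetNeg (tableIndex a b c d) <;>
    simp

theorem rootWeight_vec (a b c d e f g h i j : Fin 10) :
    rootWeight ![a, b, c, d, e, f, g, h, i, j] =
      rootDet ![a, b, c, d] * rootDet ![a, b, g, j] * rootDet ![a, e, f, g] *
      rootDet ![a, f, h, i] * rootDet ![b, d, e, f] * rootDet ![b, e, h, i] *
      rootDet ![c, d, g, h] * rootDet ![c, e, i, j] * rootDet ![c, f, h, j] *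
      rootDet ![d, g, i, j] := by
  have hq : ∀ (κ : Fin 10 → Fin 10) (q : Fin 4 → Fin 10),
      (fun l => κ (q l)) = ![κ (q 0), κ (q 1), κ (q 2), κ (q 3)] := fun κ q => by
    funext l; fin_cases l <;> rfl
  simp only [rootWeight, hq, Fin.prod_univ_succ, Fin.prod_univ_zero, mul_one, mul_assoc]
  rfl

theorem quarticHypergraph_collinear : ∀ v w : Fin 10, v ≠ w →
    ∃ b l m, quarticHypergraph.block b l = v ∧ quarticHypergraph.block b m = w := by
  decide +kernel

theorem rootWeight_eq_zero {κ : Fin 10 → Fin 10} (h : ¬ Function.Injective κ) :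
    rootWeight κ = 0 := by
  obtain ⟨v, w, hvw, hne⟩ : ∃ v w, κ v = κ w ∧ v ≠ w := by
    simpa [Function.Injective] using h
  obtain ⟨b, l, m, rfl, rfl⟩ := quarticHypergraph_collinear v w hne
  refine Finset.prod_eq_zero (Finset.mem_univ b) (Matrix.det_zero_of_row_eq (i := l) (j := m) ?_ ?_)
  · rintro rfl; exact hne rfl
  · funext j; simp [hvw]

theorem weightSum_eq (a b : Fin 10) : weightSum a b = rootSum a b := by
  simp only [rootSum, sumTen_eq, detMul_eq, unlessMem_eq, Finset.mul_sum, weightSum,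
    sum_vecCons (n := 7), sum_vecCons (n := 6), sum_vecCons (n := 5), sum_vecCons (n := 4),
    sum_vecCons (n := 3), sum_vecCons (n := 2), sum_vecCons (n := 1), sum_vecCons (n := 0)]
  refine Finset.sum_congr rfl fun c _ => Finset.sum_congr rfl fun d _ =>
    Finset.sum_congr rfl fun e _ => Finset.sum_congr rfl fun f _ =>
    Finset.sum_congr rfl fun g _ => Finset.sum_congr rfl fun h _ =>
    Finset.sum_congr rfl fun i _ => Finset.sum_congr rfl fun j _ => ?_
  rw [Fintype.sum_subsingleton _ ![]]
  by_cases hinj : Function.Injective ![a, b, c, d, e, f, g, h, i, j]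
  · have hne : ∀ v w : Fin 10, v ≠ w → (![a, b, c, d, e, f, g, h, i, j] v : Fin 10).val ≠
        (![a, b, c, d, e, f, g, h, i, j] w : Fin 10).val :=
      fun v w hvw hv => hvw (hinj (Fin.ext hv))
    have hc : (c : ℕ) ∉ [(a : ℕ), b] := by
      simpa using ⟨hne 2 0 (by decide), hne 2 1 (by decide)⟩
    have he : (e : ℕ) ∉ [(a : ℕ), b, c, d] := by
      simpa using ⟨hne 4 0 (by decide), hne 4 1 (by decide), hne 4 2 (by decide),
        hne 4 3 (by decide)⟩
    have hf : (f : ℕ) ∉ [(a : ℕ), c] := by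
      simpa using ⟨hne 5 0 (by decide), hne 5 2 (by decide)⟩
    have hg : (g : ℕ) ∉ [(b : ℕ), c, d] := by
      simpa using ⟨hne 6 1 (by decide), hne 6 2 (by decide), hne 6 3 (by decide)⟩
    have hh : (h : ℕ) ∉ [(a : ℕ), b, e, f] := by
      simpa using ⟨hne 7 0 (by decide), hne 7 1 (by decide), hne 7 4 (by decide),
        hne 7 5 (by decide)⟩
    have hi : (i : ℕ) ∉ [(c : ℕ), d, g] := by
      simpa using ⟨hne 8 2 (by decide), hne 8 3 (by decide), hne 8 6 (by decide)⟩
    rw [rootWeight_vec, if_neg hc, if_neg he, if_neg hf, if_neg hg, if_neg hh, if_neg hi]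
    ring
  · have h0 := rootWeight_eq_zero hinj
    rw [h0]
    rw [rootWeight_vec] at h0
    linear_combination (-((if (c : ℕ) ∈ [(a : ℕ), b] then 0 else 1) *
      (if (e : ℕ) ∈ [(a : ℕ), b, c, d] then 0 else 1) * (if (f : ℕ) ∈ [(a : ℕ), c] then 0 else 1) *
      (if (g : ℕ) ∈ [(b : ℕ), c, d] then 0 else 1) *
      (if (h : ℕ) ∈ [(a : ℕ), b, e, f] then 0 else 1) *
      (if (i : ℕ) ∈ [(c : ℕ), d, g] then 0 else 1)) : ℤ) * h0

/-- The symmetry induced by a `5`-cycle of the vertices of the complete graph `K_5`, whose edges are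
the roots. -/
def rotation : RootSymmetry where
  perm := ⟨![4, 5, 6, 0, 7, 8, 1, 9, 2, 3], ![3, 6, 8, 9, 0, 1, 2, 4, 5, 7], by decide, by decide⟩
  sgn := ![-1, -1, -1, -1, 1, 1, 1, 1, 1, 1]
  mat := !![-1, 1, 0, 0; -1, 0, 1, 0; -1, 0, 0, 1; -1, 0, 0, 0]
  sgn_pow := by decide
  det_pow := by decide +kernel
  map_root := by decide +kernel

/-- The symmetry induced by a transposition of `K_5`. -/
def swapOuter : RootSymmetry where
  perm := ⟨![5, 7, 2, 9, 4, 0, 6, 1, 8, 3], ![5, 7, 2, 9, 4, 0, 6, 1, 8, 3], by decide, by decide⟩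
  sgn := ![1, 1, -1, -1, 1, 1, 1, 1, 1, -1]
  mat := !![1, 0, -1, 0; 0, 1, -1, 0; 0, 0, -1, 0; 0, 0, -1, 1]
  sgn_pow := by decide
  det_pow := by decide +kernel
  map_root := by decide +kernel

/-- The symmetry that exchanges the ends of the first root. -/
def swapInner : RootSymmetry where
  perm := ⟨![0, 4, 5, 6, 1, 2, 3, 7, 8, 9], ![0, 4, 5, 6, 1, 2, 3, 7, 8, 9], by decide, by decide⟩
  sgn := ![-1, -1, -1, -1, -1, -1, -1, 1, 1, 1]
  mat := !![-1, 0, 0, 0; -1, 1, 0, 0; -1, 0, 1, 0; -1, 0, 0, 1]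
  sgn_pow := by decide
  det_pow := by decide +kernel
  map_root := by decide +kernel

/-- The symmetry that permutes cyclically the vertices of `K_5` away from the first root. -/
def rotateInner : RootSymmetry where
  perm := ⟨![0, 2, 3, 1, 5, 6, 4, 9, 7, 8], ![0, 3, 1, 2, 6, 4, 5, 8, 9, 7], by decide, by decide⟩
  sgn := ![1, 1, 1, 1, 1, 1, 1, 1, -1, -1]
  mat := !![1, 0, 0, 0; 0, 0, 1, 0; 0, 0, 0, 1; 0, 1, 0, 0]
  sgn_pow := by decide
  det_pow := by decide +kernel
  map_root := by decide +kernel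

theorem weightSum_zero_apply (b : Fin 10) :
    weightSum 0 b = ![0, 408, 408, 408, 408, 408, 408, 192, 192, 192] b := by
  have h1 : ∀ b, weightSum 0 (swapInner.perm b) = weightSum 0 b := swapInner.weightSum_perm 0
  have h2 : ∀ b, weightSum 0 (rotateInner.perm b) = weightSum 0 b := rotateInner.weightSum_perm 0
  have h00 : weightSum 0 0 = 0 := by
    rw [weightSum_eq]; decide +kernel
  have h01 : weightSum 0 1 = 408 := (weightSum_eq 0 1).trans rootSum_adjacent
  have h07 : weightSum 0 7 = 192 := (weightSum_eq 0 7).trans rootSum_disjoint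
  have h02 : weightSum 0 2 = 408 := (h2 1).trans h01
  have h03 : weightSum 0 3 = 408 := (h2 2).trans h02
  have h09 : weightSum 0 9 = 192 := (h2 7).trans h07
  have h08 : weightSum 0 8 = 192 := (h2 9).trans h09
  fin_cases b
  · exact h00
  · exact h01
  · exact h02
  · exact h03
  · exact (h1 1).trans h01
  · exact (h1 2).trans h02
  · exact (h1 3).trans h03
  · exact h07
  · exact h08
  · exact h09

theorem sum_rootWeight_eq : ∑ κ, rootWeight κ = 30240 := by
  have hperm : ∀ (g : RootSymmetry) (a : Fin 10),
      ∑ b, weightSum (g.perm a) b = ∑ b, weightSum a b := fun g a => by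
    rw [← Equiv.sum_comp g.perm]
    exact Finset.sum_congr rfl fun b _ => g.weightSum_perm a b
  have h0 : ∑ b, weightSum 0 b = 3024 := by
    simp only [weightSum_zero_apply]
    decide
  have h4 := (hperm rotation 0).trans h0
  have h7 := (hperm rotation 4).trans h4
  have h9 := (hperm rotation 7).trans h7
  have h3 := (hperm rotation 9).trans h9
  have h5 := (hperm swapOuter 0).trans h0
  have h8 := (hperm rotation 5).trans h5
  have h2 := (hperm rotation 8).trans h8
  have h6 := (hperm rotation 2).trans h2
  have h1 := (hperm rotation 6).trans h6
  have hall : ∀ a, ∑ b, weightSum a b = 3024 := by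
    intro a
    fin_cases a
    · exact h0
    · exact h1
    · exact h2
    · exact h3
    · exact h4
    · exact h5
    · exact h6
    · exact h7
    · exact h8
    · exact h9
  rw [sum_rootWeight, Finset.sum_congr rfl fun a _ => hall a]
  norm_num

theorem quarticHypergraph_invariant_ne_zero : quarticHypergraph.invariant ≠ 0 := by
  intro h
  have h1 := quarticHypergraph.aeval_invariant_sum_powTensor (K := ℂ) (fun _ => 1)
    (fun c j => (rootVector c j : ℂ))
  rw [h, map_zero] at h1
  have h2 : ∀ q : Fin 4 → Fin 10, (Matrix.of fun l j => (rootVector (q l) j : ℂ) :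
      Matrix (Fin 4) (Fin 4) ℂ).det = rootDet q := by
    intro q
    exact (RingHom.map_det (Int.castRingHom ℂ) _).symm
  have h3 : ((∑ κ, rootWeight κ : ℤ) : ℂ) = 0 := by
    rw [h1]
    push_cast [rootWeight]
    refine Finset.sum_congr rfl fun κ _ => ?_
    rw [Finset.prod_const_one, one_mul]
    exact Finset.prod_congr rfl fun b _ => (h2 _).symm
  rw [sum_rootWeight_eq] at h3
  norm_num at h3

theorem quarticHypergraph_not_injective (κ : Fin 10 → Fin 9) :
    ∃ b, ¬ Function.Injective fun l => κ (quarticHypergraph.block b l) := by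
  obtain ⟨v, w, hne, hvw⟩ := Fintype.exists_ne_map_eq_of_card_lt κ (by simp)
  obtain ⟨b, l, m, rfl, rfl⟩ := quarticHypergraph_collinear v w hne
  exact ⟨b, fun h => hne (congrArg _ (h hvw))⟩

theorem quarticHypergraph_collinearityGraph : quarticHypergraph.collinearityGraph = ⊤ := by
  ext v w
  refine ⟨fun h => h.1, fun h => ⟨h, ?_⟩⟩
  obtain ⟨b, l, m, hl, hm⟩ := quarticHypergraph_collinear v w h
  exact ⟨b, ⟨l, hl⟩, ⟨m, hm⟩⟩

theorem quarticHypergraph_invariant_isHomogeneous :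
    quarticHypergraph.invariant.IsHomogeneous 10 :=
  quarticHypergraph.invariant_isHomogeneous

theorem quarticHypergraph_invariant_mem :
    quarticHypergraph.invariant ∈ secantIdeal 9 4 3 := by
  rw [mem_secantIdeal_iff]
  intro u
  have := quarticHypergraph.aeval_invariant_eq_zero quarticHypergraph_not_injective
    (fun _ => (1 : ℂ)) u
  simpa only [one_mul] using this

theorem secantIdeal_eq_span_invariant :
    secantIdeal 9 4 3 = Ideal.span {quarticHypergraph.invariant} := by
  obtain ⟨p, hp⟩ := exists_secantIdeal_eq_span
  have hmem := quarticHypergraph_invariant_mem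
  rw [hp] at hmem
  obtain ⟨q, hq⟩ := Ideal.mem_span_singleton.1 hmem
  have hne := quarticHypergraph_invariant_ne_zero
  have hp0 : p ≠ 0 := fun h => hne (by rw [hq, h, zero_mul])
  have hq0 : q ≠ 0 := fun h => hne (by rw [hq, h, mul_zero])
  have h9 : 9 < p.totalDegree := lt_totalDegree_of_mem_secantIdeal (by norm_num)
    (hp ▸ Ideal.mem_span_singleton_self p) hp0
  have h10 : p.totalDegree + q.totalDegree = 10 := by
    rw [← MvPolynomial.totalDegree_mul_of_isDomain hp0 hq0, ← hq]
    exact quarticHypergraph_invariant_isHomogeneous.totalDegree hne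
  have hqC := MvPolynomial.totalDegree_eq_zero_iff_eq_C.1 (show q.totalDegree = 0 by omega)
  have hunit : IsUnit q := by
    rw [hqC]
    refine (IsUnit.mk0 _ fun h => hq0 ?_).map MvPolynomial.C
    rw [hqC, h, map_zero]
  rw [hp, hq, Ideal.span_singleton_mul_right_unit hunit]

end SecantInvariant

end

open SecantInvariant in
theorem mainTheorem3 :
    -- the polynomial is a nonzero invariant of degree 10 of quaternary quartics
    quarticHypergraph.invariant ≠ 0 ∧
    quarticHypergraph.invariant.IsHomogeneous 10 ∧
    (∀ g : Matrix (Fin 4) (Fin 4) ℂ, g.det = 1 →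
      ∀ F : MvPolynomial (Fin 4) ℂ, F.IsHomogeneous 4 →
        evalAt quarticHypergraph.invariant (substitute (n := 3) g F) =
          evalAt quarticHypergraph.invariant F) ∧
    -- it defines the ninth secant variety of the Veronese variety
    IsDefiningEquation quarticHypergraph.invariant (secantVariety 9 4 3) ∧
    codimension (secantVariety 9 4 3) = 1 ∧
    -- the collinearity graph is a 10-clique, and there is no proper 9-coloring
    quarticHypergraph.collinearityGraph = ⊤ ∧
    (¬ ∃ c : Fin 10 → Fin 9, quarticHypergraph.IsProperColoring c) ∧
    IsChromaticTriple 9 4 3 := by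
  have hdef : IsDefiningEquation quarticHypergraph.invariant (secantVariety 9 4 3) :=
    isDefiningEquation_of_secantIdeal_eq (by norm_num) (by norm_num)
      quarticHypergraph_invariant_isHomogeneous secantIdeal_eq_span_invariant
  have hprime : Prime quarticHypergraph.invariant := by
    rw [← Ideal.span_singleton_prime quarticHypergraph_invariant_ne_zero,
      ← secantIdeal_eq_span_invariant]
    infer_instance
  have hcodim := codimension_eq_one_of_isDefiningEquation hdef hprime
  refine ⟨quarticHypergraph_invariant_ne_zero, quarticHypergraph_invariant_isHomogeneous, ?_, hdef,
    hcodim, quarticHypergraph_collinearityGraph, ?_, hcodim, 10, 10, quarticHypergraph, hdef, ?_⟩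
  · intro g hg F hF
    rw [quarticHypergraph.evalAt_invariant_substitute (n := 3) g hF, hg, one_pow, one_mul]
  · rintro ⟨c, hc⟩
    obtain ⟨b, hb⟩ := quarticHypergraph_not_injective c
    exact hb (hc b)
  · rw [quarticHypergraph_collinearityGraph, SimpleGraph.chromaticNumber_top]
    rfl
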